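/- **Setting.** Let $\mathcal X$ be a measurable space and let $\mathcal T^1,\dots,\mathcal T^T$ be a sequence of multi-label tasks with pairwise disjoint finite label sets $\mathbb K^1,\dots,\mathbb K^T\subseteq\mathbb K$. Task $i$ has a distribution $P^i$ on $\mathcal X\times\{0,1\}^{\mathbb K^i}$ and an i.i.d. sample $\mathbb D^i=\{(\mathbf x^i_j,\mathbf y^i_j)\}_{j=1}^{n^i}$ from $P^i$; the samples of different tasks may depend on each other in any way (in particular, instances may be repeated across tasks). When task $t$ is learned, $\mathbb D^t$ is the current data and, for $i<t$, $\mathbb D^i$ is the sample of task $i$ held in the replay memory, so $n^i=\tilde n^i$ is its size there. For $k\in\mathbb K^i$ let $\mathbb D_k^{i+}$ and $\mathbb D_k^{i-}$ be the positive and negative instances of $k$ in $\mathbb D^i$, and $\tau_k^i=\min\{|\mathbb D_k^{i+}|,|\mathbb D_k^{i-}|\}/n^i$. Let $\kappa(x,x')=\langle\Phi(x),\Phi(x')\rangle_{\mathbb H}$ be a kernel with a (strongly measurable) feature map $\Phi$ into a real Hilbert space $\mathbb H$, with $\kappa(x,x)\le (r^i)^2$ for all $x\in\mathcal X$, $r^i>0$,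 and let $$\mathcal F=\{x\mapsto(\langle \mathbf w_k,\Phi(x)\rangle)_{k\in\mathbb K}:\ \|\mathbf w_k\|_{\mathbb H}\le\Lambda\ \text{for all }k\}.$$ Let $\ell(z)=\max(0,1-z)$ be the hinge loss and $\Delta_k^\pm>0$ fixed margins such that $z\mapsto\ell(z-\Delta_k^\pm)$ is $\rho_k^\pm$-Lipschitz with $\rho_k^\pm=1/\Delta_k^\pm$, and let $B$ bound the base loss: $\ell(f_k(x)-\Delta_k^+)\le B$ and $\ell(-f_k(x)-\Delta_k^-)\le B$ for all $f\in\mathcal F$, $x$, $k$. The RLDAM loss is $$\mathcal L(x^+,x^-,f_k)=\ell(f_k(x^+)-\Delta_k^+)+\ell(-f_k(x^-)-\Delta_k^-).$$ With $P_k^{i+}=P^i(x\mid y_k=1)$ and $P_k^{i-}=P^i(x\mid y_k=0)$ put $$R_{\mathbb D^i}(f)=\frac1{|\mathbb K^i|}\sum_{k\in\mathbb K^i}\mathbb E_{x_p\sim P_k^{i+},\,x_q\sim P_k^{i-}}\big[\mathcal L(x_p,x_q,f_k)\big],$$ $$R_{\mathbb D^i}(f,f')=\frac1{|\mathbb K^i|}\sum_{k\in\mathbb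 K^i}\mathbb E_{x_p\sim P_k^{i+},\,x_q\sim P_k^{i-}}\big|\mathcal L(x_p,x_q,f_k)-\mathcal L(x_p,x_q,f'_k)\big|,$$ and let $\widehat R_{\mathbb D^i}(f)$, $\widehat R_{\mathbb D^i}(f,f')$ be the same expressions with the expectation replaced by the average over all pairs in $\mathbb D_k^{i+}\times\mathbb D_k^{i-}$. For $f\in\mathcal F$ write $f^{t,i}=(f_k)_{k\in\mathbb K^i}$ for its outputs on task $i$, and likewise $F^{t-1,i}$. The discrepancy distance is $$\mathtt{disc}(\mathbb D^i,\mathbb D^t)=\sup_{f,f'\in\mathcal F}\big|\widehat R_{\mathbb D^i}(f^{t,i},f'^{t,i})-\widehat R_{\mathbb D^t}(f^{t,t},f'^{t,t})\big|.$$ **Theorem.** Fix $t\in\{1,\dots,T\}$, constants $\alpha^i,\beta^i,\gamma^i\ge0$ with $\alpha^i+\beta^i+\gamma^i=1$ for $i<t$, and $\delta>0$. Then with probability at least $1-\delta$ over the samples, whenever all $\mathbb D_k^{i\pm}$ ($i\le t$, $k\in\mathbb K^i$) are non-empty (otherwise $\tau^i_k=0$ and the empirical risk is undefined), the following holds simultaneously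 for all current models $f\in\mathcal F$ and all previous models $F^{t-1}\in\mathcal F$ (in particular for models learned from the data): $$\begin{aligned}\sum_{i=1}^{t}R_{\mathbb D^i}(f^{t,i})\le{}&\Big\{\sum_{i=1}^{t-1}\gamma^i\widehat R_{\mathbb D^i}(f^{t,i})+\widehat R_{\mathbb D^t}(f^{t,t})\Big\}+\Big\{\sum_{i=1}^{t-1}\gamma^i\epsilon^i+\epsilon^t+2\sum_{i=1}^{t-1}\beta^i(\epsilon^i+\epsilon^t)\Big\}\\&+\Big\{\sum_{i=1}^{t-1}\gamma^i\xi^i+\xi^t+B\sum_{i=1}^{t-1}\beta^i(\xi^i+\xi^t)\Big\}+\sum_{i=1}^{t-1}(\alpha^i+\beta^i)R_{\mathbb D^i}(F^{t-1,i})\\&+\Big\{\sum_{i=1}^{t-1}\alpha^i\psi^i+\sum_{i=1}^{t-1}\beta^i\psi^t\Big\}+\sum_{i=1}^{t-1}\beta^i\,\mathtt{disc}(\mathbb D^i,\mathbb D^t),\end{aligned}$$ where $$\epsilon^i=\frac{4\Lambda r^i}{\sqrt{n^i}}\Big(\frac1{|\mathbb K^i|}\sum_{k\in\mathbb K^i}\sqrt{\tfrac1{\tau_k^i}}\,(\rho_k^++\rho_k^-)\Big),\qquad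 \xi^i=6B\sqrt{\frac{\log(6/\delta)}{2n^i}}\sqrt{\frac1{|\mathbb K^i|}\sum_{k\in\mathbb K^i}\frac1{\tau_k^i}},\qquad \psi^i=R_{\mathbb D^i}(f^{t,i},F^{t-1,i}).$$ -/

import Mathlib

open MeasureTheory ProbabilityTheory Finset
open scoped ENNReal RealInnerProductSpace

namespace MLCL

noncomputable section

/-- The hinge loss `ℓ(z) = max(0, 1 - z)`. -/
def hinge (z : ℝ) : ℝ := max 0 (1 - z)

/-- The reweighted label-distribution-aware margin (RLDAM) loss
`ℓ(g(x⁺) - Δ⁺) + ℓ(-g(x⁻) - Δ⁻)` of a score function `g` on a pair of a positive and a negative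
instance. -/
def rldamLoss {X : Type*} (Δp Δm : ℝ) (g : X → ℝ) (xp xq : X) : ℝ :=
  hinge (g xp - Δp) + hinge (-(g xq) - Δm)

/-- The kernel hypothesis class: `f(x) = (⟨w_k, Φ(x)⟩)_k` with `‖w_k‖ ≤ Λ` for every label `k`. -/
def kernelClass {X K H : Type*} [NormedAddCommGroup H] [InnerProductSpace ℝ H]
    (Φ : X → H) (Λ : ℝ) : Set (X → K → ℝ) :=
  {f | ∃ W : K → H, (∀ k, ‖W k‖ ≤ Λ) ∧ ∀ x k, f x k = ⟪W k, Φ x⟫}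

/-- The outputs of a single-head model on the label set `s` of one task. -/
def taskOutputs {X K : Type*} (s : Finset K) (f : X → K → ℝ) : X → s → ℝ :=
  fun x k => f x k

section Population

/-! Expected risks of one multi-label task with label set `L` and distribution `P` on
`X × {0,1}^L`. -/

variable {X L : Type*} [MeasurableSpace X]

/-- `P(x | y_k = 1)`. -/
def posLaw (P : Measure (X × (L → Bool))) (k : L) : Measure X :=
  (ProbabilityTheory.cond P {z | z.2 k = true}).map Prod.fst

/-- `P(x | y_k = 0)`. -/
def negLaw (P : Measure (X × (L → Bool))) (k : L) : Measure X :=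
  (ProbabilityTheory.cond P {z | z.2 k = false}).map Prod.fst

/-- The expected RLDAM risk `R(f)`, the label average of
`E_{x_p ∼ P(x|y_k=1), x_q ∼ P(x|y_k=0)} L(x_p, x_q, f_k)`. -/
def risk [Fintype L] (P : Measure (X × (L → Bool))) (Δp Δm : L → ℝ) (f : X → L → ℝ) : ℝ :=
  (1 / (Fintype.card L : ℝ)) * ∑ k : L,
    ∫ p, rldamLoss (Δp k) (Δm k) (fun x => f x k) p.1 p.2 ∂((posLaw P k).prod (negLaw P k))

/-- The expected gap `R(f, f')` of two hypotheses, the label average of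
`E_{x_p ∼ P(x|y_k=1), x_q ∼ P(x|y_k=0)} |L(x_p, x_q, f_k) - L(x_p, x_q, f'_k)|`. -/
def gapRisk [Fintype L] (P : Measure (X × (L → Bool))) (Δp Δm : L → ℝ)
    (f f' : X → L → ℝ) : ℝ :=
  (1 / (Fintype.card L : ℝ)) * ∑ k : L,
    ∫ p, |rldamLoss (Δp k) (Δm k) (fun x => f x k) p.1 p.2
        - rldamLoss (Δp k) (Δm k) (fun x => f' x k) p.1 p.2|
      ∂((posLaw P k).prod (negLaw P k))

end Population

section Empirical

/-! Empirical quantities of a sample `S` of `n` labelled points of one task. -/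

variable {X L : Type*} {n : ℕ}

/-- Indices of the positive instances of the label `k`. -/
def posIdx (S : Fin n → X × (L → Bool)) (k : L) : Finset (Fin n) :=
  Finset.univ.filter fun j => (S j).2 k = true

/-- Indices of the negative instances of the label `k`. -/
def negIdx (S : Fin n → X × (L → Bool)) (k : L) : Finset (Fin n) :=
  Finset.univ.filter fun j => (S j).2 k = false

/-- Every label has a positive and a negative instance in the sample. -/
def AllLabelsSeen (S : Fin n → X × (L → Bool)) : Prop :=
  ∀ k, (posIdx S k).Nonempty ∧ (negIdx S k).Nonempty

/-- The label-wise imbalance `τ_k = min(|D_k⁺|, |D_k⁻|) / n`. -/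
def imbalance (S : Fin n → X × (L → Bool)) (k : L) : ℝ :=
  ((min (posIdx S k).card (negIdx S k).card : ℕ) : ℝ) / (n : ℝ)

variable [Fintype L]

/-- The empirical RLDAM risk `R̂(f)`. -/
def empRisk (S : Fin n → X × (L → Bool)) (Δp Δm : L → ℝ) (f : X → L → ℝ) : ℝ :=
  (1 / (Fintype.card L : ℝ)) * ∑ k : L,
    (1 / (((posIdx S k).card : ℝ) * ((negIdx S k).card : ℝ))) *
      ∑ p ∈ posIdx S k, ∑ q ∈ negIdx S k,
        rldamLoss (Δp k) (Δm k) (fun x => f x k) (S p).1 (S q).1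

/-- The gap of two hypotheses under the empirical distribution: `R(f, f')` with the laws of
the positive and the negative instances replaced by their empirical versions. -/
def empGap (S : Fin n → X × (L → Bool)) (Δp Δm : L → ℝ) (f f' : X → L → ℝ) : ℝ :=
  (1 / (Fintype.card L : ℝ)) * ∑ k : L,
    (1 / (((posIdx S k).card : ℝ) * ((negIdx S k).card : ℝ))) *
      ∑ p ∈ posIdx S k, ∑ q ∈ negIdx S k,
        |rldamLoss (Δp k) (Δm k) (fun x => f x k) (S p).1 (S q).1
          - rldamLoss (Δp k) (Δm k) (fun x => f' x k) (S p).1 (S q).1|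

/-- The complexity term
`ε = (4 Λ r / √n) · (1/|L|) ∑_k √(1/τ_k) (ρ_k⁺ + ρ_k⁻)` with `ρ_k^± = 1/Δ_k^±`. -/
def epsTerm (S : Fin n → X × (L → Bool)) (Δp Δm : L → ℝ) (Λ r : ℝ) : ℝ :=
  4 * Λ * r / Real.sqrt n *
    ((1 / (Fintype.card L : ℝ)) * ∑ k : L,
      Real.sqrt (1 / imbalance S k) * (1 / Δp k + 1 / Δm k))

/-- The concentration term
`ξ = 6 B √(log(6/δ) / (2n)) · √((1/|L|) ∑_k 1/τ_k)`. -/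
def xiTerm (S : Fin n → X × (L → Bool)) (B δ : ℝ) : ℝ :=
  6 * B * Real.sqrt (Real.log (6 / δ) / (2 * n)) *
    Real.sqrt ((1 / (Fintype.card L : ℝ)) * ∑ k : L, 1 / imbalance S k)

end Empirical

/-- The discrepancy distance over `ℱ` between (the empirical distributions of) the samples of two
tasks with label sets `s` and `s'`:
`sup_{f, f' ∈ ℱ} |R_S(f^s, f'^s) - R_{S'}(f^{s'}, f'^{s'})|`. -/
def disc {X K : Type*} {n n' : ℕ} {s s' : Finset K}
    (ℱ : Set (X → K → ℝ)) (Δp Δm : K → ℝ)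
    (S : Fin n → X × (s → Bool)) (S' : Fin n' → X × (s' → Bool)) : ℝ :=
  sSup {d | ∃ f ∈ ℱ, ∃ f' ∈ ℱ,
    d = |empGap S (fun k => Δp k) (fun k => Δm k) (taskOutputs s f) (taskOutputs s f')
      - empGap S' (fun k => Δp k) (fun k => Δm k) (taskOutputs s' f) (taskOutputs s' f')|}

end

end MLCL

/-!
# A risk bound for multi-label learning with replay

The risk of an old task is split into the shares `γ`, `α`, `β`: the first is estimated on the replay
memory, the second by the previous model `F` and the gap between `f` and `F`, and the third also by
the previous model, with the gap transported to the current task through the discrepancy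
(`sum_risk_le`). What is left is a nonnegative combination, over all labels of all tasks, of uniform
deviations between means and two-sample averages, each of which has to be compared with its own
random threshold, proportional to `τ_k^{-1/2}`.

*One label.* Conditionally on the positions of the positive instances of a single label `k`, the
instances are independent with laws `P(x | y_k = 1)` and `P(x | y_k = 0)` (`setLIntegral_pattern`).
Freezing one argument of the pair loss at a time, symmetrization (`integral_ciSup_centered_le`) and
the contraction principle (`rad_contract`) bound the conditional expectation of the uniform
deviation (`integral_ciSup_sub_pairMean_le`), and the bounded differences inequality
(`integral_exp_bounded_differences`) shows that it is sub-Gaussian around it.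

*All labels and tasks.* The dependence between labels and tasks is arbitrary, and the confidence
level `δ` in the thresholds does not shrink with their number, so a union bound is not available.
Instead, tails are turned into first moments, which can be added up. For each label there is a
constant level `b` such that the positive part of `b + (deviation - threshold)`, on the event that
both classes of the label occur, has expectation at most `δ b` (`exists_lintegral_excess_le`). By
Markov's inequality the weighted sum of these positive parts exceeds the weighted sum of the levels
with probability at most `δ`, and otherwise the weighted sum of the deviations is at most that of
the thresholds (`measure_weighted_sum_pos_le`). The level `b` is proportional to a number `y` below
which `τ_k^{-1/2}` falls with probability at most `δ / 2`; that such a `y` is comparable to typical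
values of `τ_k^{-1/2}` is a property of binomial counts, and the constant `6` in the concentration
term pays for the remaining powers of `δ`.

*Uniformity.* The range of the feature map is separable, so the hypotheses are approximated by those
with weights in a countable dense subset of a ball (`exists_dense_scores`), which is exhausted by
finite families.
-/

namespace MLCL

noncomputable section

/-! ### Rademacher averages of finite families -/

/-- The Rademacher sign `±1` encoded by a Boolean. -/
def sgn (b : Bool) : ℝ := if b then 1 else -1

lemma sgn_not (b : Bool) : sgn (!b) = -sgn b := by cases b <;> simp [sgn]

lemma sgn_mul_self (b : Bool) : sgn b * sgn b = 1 := by cases b <;> simp [sgn]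

/-- The Rademacher average over the coordinates in `A` of a family `t` of real vectors indexed by
`ι`: `E_σ sup_i ∑_{j ∈ A} σ_j t_{j,i}` with `σ` uniform on `{±1}^J`, not divided by `|A|`. -/
def rad {J ι : Type*} [Fintype J] [DecidableEq J] (A : Finset J) (t : J → ι → ℝ) : ℝ :=
  (∑ σ : J → Bool, ⨆ i, ∑ j ∈ A, sgn (σ j) * t j i) / Fintype.card (J → Bool)

section Signs

variable {J ι : Type*} [Fintype J] [DecidableEq J]

lemma sum_flip {M : Type*} [AddCommMonoid M] (F : (J → Bool) → M) (j : J) :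
    ∑ σ : J → Bool, F (Function.update σ j (!σ j)) = ∑ σ, F σ := by
  have hinv : Function.Involutive fun σ : J → Bool => Function.update σ j (!σ j) := by
    intro σ; ext l; by_cases h : l = j
    · subst h; simp
    · simp [h]
  exact Equiv.sum_comp hinv.toPerm F

lemma sum_not {M : Type*} [AddCommMonoid M] (F : (J → Bool) → M) :
    ∑ σ : J → Bool, F (fun j => !σ j) = ∑ σ, F σ := by
  have hinv : Function.Involutive fun (σ : J → Bool) j => !σ j := by intro σ; ext l; simp
  exact Equiv.sum_comp hinv.toPerm F

lemma card_signs_pos : (0 : ℝ) < Fintype.card (J → Bool) := by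
  exact_mod_cast Fintype.card_pos

lemma sum_sgn_mul_sgn (j l : J) :
    ∑ σ : J → Bool, sgn (σ j) * sgn (σ l) = if j = l then (Fintype.card (J → Bool) : ℝ) else 0 := by
  split_ifs with h
  · subst h; simp [sgn_mul_self]
  · have := sum_flip (fun σ : J → Bool => sgn (σ j) * sgn (σ l)) j
    simp only [Function.update_self, Function.update_of_ne (Ne.symm h), sgn_not, neg_mul,
      Finset.sum_neg_distrib] at this
    linarith

/-- Khinchine's inequality with constant one in a Hilbert space:
`E_σ ‖∑ σ_j v_j‖ ≤ √(∑ ‖v_j‖²)`. -/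
lemma sum_norm_signed_le {H : Type*} [NormedAddCommGroup H] [InnerProductSpace ℝ H]
    (A : Finset J) (v : J → H) {r : ℝ} (hr : 0 ≤ r) (hv : ∀ j, ‖v j‖ ≤ r) :
    ∑ σ : J → Bool, ‖∑ j ∈ A, sgn (σ j) • v j‖
      ≤ Fintype.card (J → Bool) * (r * √(A.card : ℝ)) := by
  have h2 : ∑ σ : J → Bool, ‖∑ j ∈ A, sgn (σ j) • v j‖ ^ 2
      = Fintype.card (J → Bool) * ∑ j ∈ A, ‖v j‖ ^ 2 := by
    have : ∀ σ : J → Bool, ‖∑ j ∈ A, sgn (σ j) • v j‖ ^ 2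
        = ∑ j ∈ A, ∑ l ∈ A, sgn (σ j) * sgn (σ l) * ⟪v j, v l⟫ := by
      intro σ
      rw [← real_inner_self_eq_norm_sq, sum_inner]
      refine Finset.sum_congr rfl fun j _ => ?_
      rw [inner_sum]
      refine Finset.sum_congr rfl fun l _ => ?_
      rw [real_inner_smul_left, real_inner_smul_right]; ring
    simp_rw [this]
    rw [Finset.sum_comm, Finset.mul_sum]
    refine Finset.sum_congr rfl fun j hj => ?_
    rw [Finset.sum_comm]
    simp_rw [← Finset.sum_mul, sum_sgn_mul_sgn]
    simp [hj]
  have h3 : ∑ j ∈ A, ‖v j‖ ^ 2 ≤ A.card * r ^ 2 := by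
    rw [← nsmul_eq_mul]
    exact Finset.sum_le_card_nsmul _ _ _ fun j _ => by
      exact pow_le_pow_left₀ (norm_nonneg _) (hv j) 2
  have h1 := sq_sum_le_card_mul_sum_sq (s := (Finset.univ : Finset (J → Bool)))
    (f := fun σ => ‖∑ j ∈ A, sgn (σ j) • v j‖)
  rw [h2, Finset.card_univ] at h1
  refine abs_le_of_sq_le_sq' ?_ (by positivity) |>.2
  refine h1.trans ?_
  rw [mul_pow, mul_pow, Real.sq_sqrt (Nat.cast_nonneg _)]
  nlinarith [mul_le_mul_of_nonneg_left h3 (sq_nonneg (Fintype.card (J → Bool) : ℝ))]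

lemma rad_neg (A : Finset J) (t : J → ι → ℝ) : rad A (fun j i => -t j i) = rad A t := by
  unfold rad
  rw [← sum_not]
  simp [sgn_not]

end Signs

lemma le_ciSup_finite {ι : Type*} [Finite ι] (f : ι → ℝ) (i : ι) : f i ≤ ⨆ i, f i :=
  le_ciSup (Set.finite_range f).bddAbove i

section Rademacher

variable {J ι : Type*} [Fintype J] [DecidableEq J] [Nonempty ι]

lemma rad_inner_le {H : Type*} [NormedAddCommGroup H] [InnerProductSpace ℝ H]
    (A : Finset J) (w : ι → H) (v : J → H) {Λ r : ℝ} (hr : 0 ≤ r)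
    (hw : ∀ i, ‖w i‖ ≤ Λ) (hv : ∀ j, ‖v j‖ ≤ r) :
    rad A (fun j i => ⟪w i, v j⟫) ≤ Λ * r * √(A.card : ℝ) := by
  have hΛ : 0 ≤ Λ := (norm_nonneg _).trans (hw (Classical.arbitrary ι))
  unfold rad
  rw [div_le_iff₀ card_signs_pos]
  calc _ ≤ ∑ σ : J → Bool, Λ * ‖∑ j ∈ A, sgn (σ j) • v j‖ := by
        gcongr with σ
        refine ciSup_le fun i => ?_
        have : ∑ j ∈ A, sgn (σ j) * ⟪w i, v j⟫ = ⟪w i, ∑ j ∈ A, sgn (σ j) • v j⟫ := by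
          simp [inner_sum, real_inner_smul_right]
        rw [this]
        exact (real_inner_le_norm _ _).trans
          (mul_le_mul_of_nonneg_right (hw i) (norm_nonneg _))
    _ ≤ Λ * (Fintype.card (J → Bool) * (r * √(A.card : ℝ))) := by
        rw [← Finset.mul_sum]
        exact mul_le_mul_of_nonneg_left (sum_norm_signed_le A v hr hv) hΛ
    _ = _ := by ring

variable [Finite ι]

lemma rad_add_le (A : Finset J) (t t' : J → ι → ℝ) :
    rad A (fun j i => t j i + t' j i) ≤ rad A t + rad A t' := by
  unfold rad
  rw [← add_div, ← Finset.sum_add_distrib]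
  gcongr with σ
  refine ciSup_le fun i => ?_
  simp_rw [mul_add, Finset.sum_add_distrib]
  exact add_le_add (le_ciSup_finite (fun i => ∑ j ∈ A, sgn (σ j) * t j i) i)
    (le_ciSup_finite (fun i => ∑ j ∈ A, sgn (σ j) * t' j i) i)

/-- The two-point comparison behind the contraction principle. -/
lemma ciSup_add_ciSup_contract (u φ t : ι → ℝ) (h : ∀ i i', |φ i - φ i'| ≤ |t i - t i'|) :
    (⨆ i, (u i + φ i)) + (⨆ i, (u i - φ i)) ≤ (⨆ i, (u i + t i)) + ⨆ i, (u i - t i) := by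
  obtain ⟨i, hi⟩ := exists_eq_ciSup_of_finite (f := fun i => u i + φ i)
  obtain ⟨i', hi'⟩ := exists_eq_ciSup_of_finite (f := fun i => u i - φ i)
  rw [← hi, ← hi']
  have h1 := (le_abs_self _).trans (h i i')
  have a1 := le_ciSup_finite (fun i => u i + t i) i
  have a2 := le_ciSup_finite (fun i => u i + t i) i'
  have b1 := le_ciSup_finite (fun i => u i - t i) i
  have b2 := le_ciSup_finite (fun i => u i - t i) i'
  rcases abs_cases (t i - t i') with ⟨h, _⟩ | ⟨h, _⟩ <;> linarith

/-- Replacing the coordinates one at a time needs an offset `u` that may depend on the signs outside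
`S`. -/
lemma sum_ciSup_contract (S : Finset J) (φ t : J → ι → ℝ)
    (h : ∀ j ∈ S, ∀ i i', |φ j i - φ j i'| ≤ |t j i - t j i'|) :
    ∀ u : (J → Bool) → ι → ℝ,
      (∀ j ∈ S, ∀ σ, u (Function.update σ j (!σ j)) = u σ) →
      ∑ σ : J → Bool, ⨆ i, (u σ i + ∑ j ∈ S, sgn (σ j) * φ j i)
        ≤ ∑ σ : J → Bool, ⨆ i, (u σ i + ∑ j ∈ S, sgn (σ j) * t j i) := by
  induction S using Finset.induction_on with
  | empty => intro u _; simp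
  | insert j S hj ih =>
    intro u hu
    have hS : ∀ (ψ : J → ι → ℝ) (σ : J → Bool) (i : ι),
        ∑ l ∈ S, sgn (Function.update σ j (!σ j) l) * ψ l i = ∑ l ∈ S, sgn (σ l) * ψ l i := by
      intro ψ σ i
      refine Finset.sum_congr rfl fun l hl => ?_
      rw [Function.update_of_ne (ne_of_mem_of_not_mem hl hj)]
    -- Averaging over the two values of `σ j` reduces to the two-point comparison.
    have step : ∑ σ : J → Bool, ⨆ i, (u σ i + ∑ l ∈ S, sgn (σ l) * φ l i + sgn (σ j) * φ j i)
        ≤ ∑ σ : J → Bool, ⨆ i, (u σ i + ∑ l ∈ S, sgn (σ l) * φ l i + sgn (σ j) * t j i) := by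
      have key : ∀ ψ : ι → ℝ,
          2 * ∑ σ : J → Bool, ⨆ i, (u σ i + ∑ l ∈ S, sgn (σ l) * φ l i + sgn (σ j) * ψ i)
          = ∑ σ : J → Bool, ((⨆ i, (u σ i + ∑ l ∈ S, sgn (σ l) * φ l i + sgn (σ j) * ψ i))
            + ⨆ i, (u σ i + ∑ l ∈ S, sgn (σ l) * φ l i - sgn (σ j) * ψ i)) := by
        intro ψ
        rw [Finset.sum_add_distrib, two_mul]
        congr 1
        rw [← sum_flip _ j]
        refine Finset.sum_congr rfl fun σ _ => ?_
        simp only [hS, hu j (Finset.mem_insert_self j S), Function.update_self, sgn_not]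
        simp [sub_eq_add_neg]
      have := (key (φ j)).le.trans ((Finset.sum_le_sum fun σ _ =>
        ciSup_add_ciSup_contract (fun i => u σ i + ∑ l ∈ S, sgn (σ l) * φ l i)
          (fun i => sgn (σ j) * φ j i) (fun i => sgn (σ j) * t j i) ?_).trans (key (t j)).ge)
      · linarith
      · intro i i'
        rw [← mul_sub, ← mul_sub, abs_mul, abs_mul]
        exact mul_le_mul_of_nonneg_left (h j (Finset.mem_insert_self j S) i i') (abs_nonneg _)
    have rest := ih (fun l hl => h l (Finset.mem_insert_of_mem hl))
      (fun σ i => u σ i + sgn (σ j) * t j i) (by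
        intro l hl σ
        have hne : j ≠ l := fun h => hj (h ▸ hl)
        funext i
        rw [hu l (Finset.mem_insert_of_mem hl), Function.update_of_ne hne])
    simp only [Finset.sum_insert hj]
    calc _ = _ := by
          refine Finset.sum_congr rfl fun σ _ => ?_
          congr 1; funext i; ring
      _ ≤ _ := step
      _ = _ := by
          refine Finset.sum_congr rfl fun σ _ => ?_
          congr 1; funext i
          exact add_right_comm _ _ _
      _ ≤ _ := rest
      _ = _ := by
          refine Finset.sum_congr rfl fun σ _ => ?_
          congr 1; funext i; ring

/-- **Contraction principle** (Ledoux–Talagrand), in the one-sided form, for families dominated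
coordinatewise in increments. -/
lemma rad_contract (A : Finset J) (φ t : J → ι → ℝ)
    (h : ∀ j ∈ A, ∀ i i', |φ j i - φ j i'| ≤ |t j i - t j i'|) : rad A φ ≤ rad A t := by
  unfold rad
  gcongr ?_ / _
  simpa using sum_ciSup_contract A φ t h (fun _ _ => 0) (fun _ _ _ => rfl)

end Rademacher

/-! ### Symmetrization -/

section Bounded

lemma integrable_of_abs_le {Y : Type*} [MeasurableSpace Y] {ν : Measure Y} [IsFiniteMeasure ν]
    {f : Y → ℝ} (hf : Measurable f) {M : ℝ} (h : ∀ y, |f y| ≤ M) : Integrable f ν :=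
  Integrable.of_bound hf.aestronglyMeasurable M (ae_of_all _ h)

lemma abs_integral_le_of_abs_le {Y : Type*} [MeasurableSpace Y] {ν : Measure Y}
    [IsProbabilityMeasure ν] {f : Y → ℝ} {M : ℝ} (h : ∀ y, |f y| ≤ M) : |∫ y, f y ∂ν| ≤ M := by
  have := norm_integral_le_of_norm_le_const (μ := ν) (f := f) (ae_of_all _ h)
  simpa using this

lemma abs_ciSup_le {ι : Type*} [Finite ι] [Nonempty ι] {f : ι → ℝ} {M : ℝ} (h : ∀ i, |f i| ≤ M) :
    |⨆ i, f i| ≤ M := by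
  obtain ⟨i, hi⟩ := exists_eq_ciSup_of_finite (f := f)
  rw [← hi]; exact h i

lemma ciSup_integral_le {Y ι : Type*} [MeasurableSpace Y] {ν : Measure Y} [IsProbabilityMeasure ν]
    [Finite ι] [Nonempty ι] {f : ι → Y → ℝ} (hf : ∀ i, Measurable (f i)) {M : ℝ}
    (h : ∀ i y, |f i y| ≤ M) : ⨆ i, ∫ y, f i y ∂ν ≤ ∫ y, ⨆ i, f i y ∂ν := by
  refine ciSup_le fun i => ?_
  refine integral_mono (integrable_of_abs_le (hf i) (h i))
    (integrable_of_abs_le (Measurable.iSup hf) fun y => abs_ciSup_le fun i => h i y) fun y => ?_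
  exact le_ciSup_finite (fun i => f i y) i

end Bounded

section Symmetrization

variable {J X ι : Type*} [Fintype J] [MeasurableSpace X]

/-- Exchange of the coordinates of two samples where `σ` is false. -/
def swapCoords (σ : J → Bool) (z : (J → X) × (J → X)) : (J → X) × (J → X) :=
  (fun j => if σ j then z.1 j else z.2 j, fun j => if σ j then z.2 j else z.1 j)

lemma measurePreserving_swapCoords (Q : J → Measure X) [∀ j, IsProbabilityMeasure (Q j)]
    (σ : J → Bool) :
    MeasurePreserving (swapCoords σ) ((Measure.pi Q).prod (Measure.pi Q))
      ((Measure.pi Q).prod (Measure.pi Q)) := by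
  have e := measurePreserving_arrowProdEquivProdArrow X X J Q Q
  have hs : MeasurePreserving (fun (z : J → X × X) j => (if σ j then id else Prod.swap) (z j))
      (Measure.pi fun j => (Q j).prod (Q j)) (Measure.pi fun j => (Q j).prod (Q j)) := by
    refine measurePreserving_pi _ _ fun j => ?_
    split_ifs
    · exact MeasurePreserving.id _
    · exact Measure.measurePreserving_swap
  have := e.comp (hs.comp (e.symm _))
  convert this using 1
  funext z
  refine Prod.ext ?_ ?_ <;> funext j <;>
    simp only [swapCoords, MeasurableEquiv.arrowProdEquivProdArrow, Function.comp,
      MeasurableEquiv.coe_mk, Equiv.arrowProdEquivProdArrow, MeasurableEquiv.symm_mk,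
      Equiv.coe_fn_mk, Equiv.coe_fn_symm_mk] <;>
    split_ifs <;> rfl

lemma integral_pi_eval (Q : J → Measure X) [∀ j, IsProbabilityMeasure (Q j)] {f : X → ℝ}
    (hf : Measurable f) (j : J) : ∫ x, f (x j) ∂(Measure.pi Q) = ∫ y, f y ∂(Q j) := by
  have := measurePreserving_eval Q j
  rw [← this.map_eq, integral_map this.measurable.aemeasurable hf.aestronglyMeasurable]

variable [DecidableEq J] [Finite ι] [Nonempty ι]

/-- **Symmetrization**: for independent, not necessarily identically distributed, points the
expected supremum of the centred empirical process is at most twice a bound on the Rademacher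
averages of the class. -/
lemma integral_ciSup_centered_le (Q : J → Measure X) [∀ j, IsProbabilityMeasure (Q j)]
    (A : Finset J) (g : ι → X → ℝ) (hg : ∀ i, Measurable (g i)) {M : ℝ} (hM : ∀ i x, |g i x| ≤ M)
    {R : ℝ} (hR : ∀ x : J → X, rad A (fun j i => g i (x j)) ≤ R) :
    ∫ x, ⨆ i, ∑ j ∈ A, ((∫ y, g i y ∂(Q j)) - g i (x j)) ∂(Measure.pi Q) ≤ 2 * R := by
  set π := Measure.pi Q
  -- `S σ (x, x')` is the symmetrized supremum for two independent samples `x`, `x'`.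
  let S : (J → Bool) → (J → X) × (J → X) → ℝ :=
    fun σ z => ⨆ i, ∑ j ∈ A, sgn (σ j) * (g i (z.2 j) - g i (z.1 j))
  have hterm : ∀ i (σ : J → Bool), Measurable fun z : (J → X) × (J → X) =>
      ∑ j ∈ A, sgn (σ j) * (g i (z.2 j) - g i (z.1 j)) := by
    intro i σ
    refine Finset.measurable_sum _ fun j _ => ?_
    have h1 : Measurable fun z : (J → X) × (J → X) => g i (z.2 j) := (hg i).comp (by fun_prop)
    have h2 : Measurable fun z : (J → X) × (J → X) => g i (z.1 j) := (hg i).comp (by fun_prop)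
    exact (h1.sub h2).const_mul _
  have htermb : ∀ i (σ : J → Bool) (z : (J → X) × (J → X)),
      |∑ j ∈ A, sgn (σ j) * (g i (z.2 j) - g i (z.1 j))| ≤ A.card * (2 * M) := by
    intro i σ z
    refine (Finset.abs_sum_le_sum_abs _ _).trans ?_
    rw [← nsmul_eq_mul]
    refine Finset.sum_le_card_nsmul _ _ _ fun j _ => ?_
    rw [abs_mul]
    have h1 : |sgn (σ j)| = 1 := by cases σ j <;> simp [sgn]
    rw [h1, one_mul]
    have := abs_sub (g i (z.2 j)) (g i (z.1 j))
    linarith [hM i (z.2 j), hM i (z.1 j)]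
  have hSm : ∀ σ, Measurable (S σ) := fun σ => Measurable.iSup fun i => hterm i σ
  have hSb : ∀ σ z, |S σ z| ≤ A.card * (2 * M) := fun σ z => abs_ciSup_le fun i => htermb i σ z
  have hSi : ∀ σ, Integrable (S σ) (π.prod π) := fun σ => integrable_of_abs_le (hSm σ) (hSb σ)
  have hcoord : ∀ i j, Integrable (fun x : J → X => g i (x j)) π := fun i j =>
    integrable_of_abs_le ((hg i).comp (measurable_pi_apply j)) fun x => hM i (x j)
  have step1 : ∫ x, ⨆ i, ∑ j ∈ A, ((∫ y, g i y ∂(Q j)) - g i (x j)) ∂π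
      ≤ ∫ z, S (fun _ => true) z ∂(π.prod π) := by
    rw [integral_prod _ (hSi _)]
    refine integral_mono ?_ (hSi _).integral_prod_left fun x => ?_
    · refine integrable_of_abs_le (M := A.card * (2 * M)) (Measurable.iSup fun i =>
        Finset.measurable_sum _ fun j _ =>
          measurable_const.sub ((hg i).comp (measurable_pi_apply j))) fun x => ?_
      refine abs_ciSup_le fun i => ?_
      refine (Finset.abs_sum_le_sum_abs _ _).trans ?_
      rw [← nsmul_eq_mul]
      refine Finset.sum_le_card_nsmul _ _ _ fun j _ => ?_
      have := abs_sub (∫ y, g i y ∂(Q j)) (g i (x j))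
      linarith [hM i (x j), abs_integral_le_of_abs_le (ν := Q j) (hM i)]
    · have : ∀ i, ∑ j ∈ A, ((∫ y, g i y ∂(Q j)) - g i (x j))
          = ∫ x', ∑ j ∈ A, sgn true * (g i (x' j) - g i (x j)) ∂π := by
        intro i
        have hi : ∀ j, Integrable (fun x' : J → X => sgn true * (g i (x' j) - g i (x j))) π :=
          fun j => ((hcoord i j).sub (integrable_const _)).const_mul _
        rw [integral_finsetSum _ fun j _ => hi j]
        refine Finset.sum_congr rfl fun j _ => ?_
        rw [integral_const_mul, integral_sub (hcoord i j) (integrable_const _),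
          integral_pi_eval Q (hg i) j]
        simp [sgn]
      simp only [this]
      exact ciSup_integral_le (fun i => (hterm i fun _ => true).comp measurable_prodMk_left)
        fun i x' => htermb i (fun _ => true) (x, x')
  have step2 : ∀ σ, ∫ z, S (fun _ => true) z ∂(π.prod π) = ∫ z, S σ z ∂(π.prod π) := by
    intro σ
    have hp := measurePreserving_swapCoords Q σ
    rw [← hp.map_eq, integral_map hp.measurable.aemeasurable (hSm _).aestronglyMeasurable]
    rw [hp.map_eq]
    congr 1; funext z
    simp only [S]
    congr 1; funext i
    refine Finset.sum_congr rfl fun j _ => ?_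
    cases h : σ j <;> simp [swapCoords, h, sgn]
  have step3 : ∀ z, (∑ σ, S σ z) / Fintype.card (J → Bool) ≤ 2 * R := by
    intro z
    have h1 := rad_add_le A (fun j i => g i (z.2 j)) (fun j i => -g i (z.1 j))
    rw [rad_neg A (fun j i => g i (z.1 j))] at h1
    have : (∑ σ, S σ z) / Fintype.card (J → Bool)
        = rad A (fun j i => g i (z.2 j) + -g i (z.1 j)) := by
      simp [S, rad, sub_eq_add_neg]
    rw [this]
    linarith [hR z.1, hR z.2]
  calc _ ≤ _ := step1
    _ = (∑ σ : J → Bool, ∫ z, S σ z ∂(π.prod π)) / Fintype.card (J → Bool) := by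
        simp_rw [← step2]
        rw [Finset.sum_const, Finset.card_univ, nsmul_eq_mul,
          mul_div_cancel_left₀ _ card_signs_pos.ne']
    _ = ∫ z, (∑ σ : J → Bool, S σ z) / Fintype.card (J → Bool) ∂(π.prod π) := by
        rw [integral_div, integral_finsetSum _ fun σ _ => hSi σ]
    _ ≤ ∫ _, 2 * R ∂(π.prod π) := by
        exact integral_mono ((integrable_finsetSum _ fun σ _ => hSi σ).div_const _)
          (integrable_const _) step3
    _ = 2 * R := by simp

end Symmetrization

/-! ### Expected uniform deviation of two-sample averages -/

section TwoSample

variable {J X : Type*}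

/-- The average of a pair function `h` over all pairs of a sample point with index in `A` and one
with index in `C`. -/
def pairMean (A C : Finset J) (h : X → X → ℝ) (x : J → X) : ℝ :=
  (1 / ((A.card : ℝ) * (C.card : ℝ))) * ∑ p ∈ A, ∑ q ∈ C, h (x p) (x q)

lemma abs_pairMean_le (A C : Finset J) {h : X → X → ℝ} {M : ℝ} (hM0 : 0 ≤ M)
    (hM : ∀ p q, |h p q| ≤ M) (x : J → X) : |pairMean A C h x| ≤ M := by
  have h1 : |∑ p ∈ A, ∑ q ∈ C, h (x p) (x q)| ≤ A.card * (C.card * M) := by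
    refine (Finset.abs_sum_le_sum_abs _ _).trans ?_
    rw [← nsmul_eq_mul]
    refine Finset.sum_le_card_nsmul _ _ _ fun p _ => ?_
    refine (Finset.abs_sum_le_sum_abs _ _).trans ?_
    rw [← nsmul_eq_mul]
    exact Finset.sum_le_card_nsmul _ _ _ fun q _ => hM _ _
  unfold pairMean
  rw [abs_mul, abs_of_nonneg (by positivity), one_div]
  rcases Nat.eq_zero_or_pos A.card with hA | hA
  · simp [hA, hM0]
  rcases Nat.eq_zero_or_pos C.card with hC | hC
  · simp [hC, hM0]
  have hA' : (0 : ℝ) < A.card := by exact_mod_cast hA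
  have hC' : (0 : ℝ) < C.card := by exact_mod_cast hC
  rw [inv_mul_le_iff₀ (by positivity)]
  linarith

variable [MeasurableSpace X]

lemma measurable_pairMean (A C : Finset J) {h : X → X → ℝ} (hh : Measurable (Function.uncurry h)) :
    Measurable (pairMean A C h) := by
  unfold pairMean
  refine Measurable.const_mul (Finset.measurable_sum _ fun p _ =>
    Finset.measurable_sum _ fun q _ => ?_) _
  exact hh.comp (f := fun x : J → X => (x p, x q)) (by fun_prop)

variable [Fintype J] [DecidableEq J] {ι : Type*} [Finite ι] [Nonempty ι]

lemma integral_ciSup_sub_mean_le (Q : J → Measure X) [∀ j, IsProbabilityMeasure (Q j)]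
    {A : Finset J} (hA : A.Nonempty) {ν : Measure X} (hQ : ∀ j ∈ A, Q j = ν)
    (g : ι → X → ℝ) (hg : ∀ i, Measurable (g i)) {M : ℝ} (hM : ∀ i x, |g i x| ≤ M)
    {R : ℝ} (hR : ∀ x : J → X, rad A (fun j i => g i (x j)) ≤ R * √(A.card : ℝ)) :
    ∫ x, ⨆ i, ((∫ y, g i y ∂ν) - (1 / (A.card : ℝ)) * ∑ j ∈ A, g i (x j)) ∂(Measure.pi Q)
      ≤ 2 * R / √(A.card : ℝ) := by
  have hA' : (0 : ℝ) < A.card := by exact_mod_cast hA.card_pos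
  have heq : ∀ x : J → X, ⨆ i, ((∫ y, g i y ∂ν) - (1 / (A.card : ℝ)) * ∑ j ∈ A, g i (x j))
      = (1 / (A.card : ℝ)) * ⨆ i, ∑ j ∈ A, ((∫ y, g i y ∂(Q j)) - g i (x j)) := by
    intro x
    rw [Real.mul_iSup_of_nonneg (by positivity)]
    congr 1; funext i
    have h1 : ∑ j ∈ A, ∫ y, g i y ∂(Q j) = A.card * ∫ y, g i y ∂ν := by
      rw [← nsmul_eq_mul, ← Finset.sum_const]
      exact Finset.sum_congr rfl fun j hj => by rw [hQ j hj]
    rw [Finset.sum_sub_distrib, h1]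
    field_simp
  simp_rw [heq]
  rw [integral_const_mul]
  have h := integral_ciSup_centered_le Q A g hg hM hR
  calc _ ≤ (1 / (A.card : ℝ)) * (2 * (R * √(A.card : ℝ))) :=
        mul_le_mul_of_nonneg_left h (by positivity)
    _ = _ := by
      have hs : √(A.card : ℝ) ≠ 0 := (Real.sqrt_pos.2 hA').ne'
      field_simp
      rw [Real.sq_sqrt hA'.le, mul_comm]

/-- The expected uniform deviation of two-sample averages. The average over `C` is replaced by its
mean for each fixed point of `A`, and the average over `A` by its mean for each fixed second
argument; only the Rademacher averages of the sections of `h` enter. -/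
lemma integral_ciSup_sub_pairMean_le (Q : J → Measure X) [∀ j, IsProbabilityMeasure (Q j)]
    {A C : Finset J} (hA : A.Nonempty) (hC : C.Nonempty) (hAC : Disjoint A C) {νp νm : Measure X}
    [IsProbabilityMeasure νp] [IsProbabilityMeasure νm]
    (hQA : ∀ j ∈ A, Q j = νp) (hQC : ∀ j ∈ C, Q j = νm)
    (h : ι → X → X → ℝ) (hh : ∀ i, Measurable (Function.uncurry (h i))) {M : ℝ}
    (hM : ∀ i p q, |h i p q| ≤ M) {R : ℝ}
    (hRp : ∀ q, ∀ x : J → X, rad A (fun j i => h i (x j) q) ≤ R * √(A.card : ℝ))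
    (hRm : ∀ p, ∀ x : J → X, rad C (fun j i => h i p (x j)) ≤ R * √(C.card : ℝ)) :
    ∫ x, ⨆ i, ((∫ z, h i z.1 z.2 ∂(νp.prod νm)) - pairMean A C (h i) x) ∂(Measure.pi Q)
      ≤ 2 * R * (1 / √(A.card : ℝ) + 1 / √(C.card : ℝ)) := by
  have hA' : (0 : ℝ) < A.card := by exact_mod_cast hA.card_pos
  have hC' : (0 : ℝ) < C.card := by exact_mod_cast hC.card_pos
  set π := Measure.pi Q
  obtain ⟨x₀⟩ : Nonempty X := νp.nonempty_of_neZero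
  have hM0 : 0 ≤ M := (abs_nonneg _).trans (hM (Classical.arbitrary ι) x₀ x₀)
  have hp : ∀ i q, Measurable fun p => h i p q := fun i q => (hh i).comp measurable_prodMk_right
  have hq : ∀ i p, Measurable fun q => h i p q := fun i p => (hh i).comp measurable_prodMk_left
  -- uniform deviations of the one-sample averages with the other argument frozen
  let U : X → (J → X) → ℝ := fun q x =>
    ⨆ i, ((∫ p, h i p q ∂νp) - (1 / (A.card : ℝ)) * ∑ j ∈ A, h i (x j) q)
  let V : X → (J → X) → ℝ := fun p x =>
    ⨆ i, ((∫ q, h i p q ∂νm) - (1 / (C.card : ℝ)) * ∑ j ∈ C, h i p (x j))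
  have hmean : ∀ (S : Finset J), (0 : ℝ) < S.card → ∀ f : X → ℝ, (∀ y, |f y| ≤ M) → ∀ x : J → X,
      |(1 / (S.card : ℝ)) * ∑ j ∈ S, f (x j)| ≤ M := by
    intro S hS f hf x
    rw [abs_mul, abs_of_nonneg (by positivity), one_div, inv_mul_le_iff₀ hS]
    refine (Finset.abs_sum_le_sum_abs _ _).trans ?_
    rw [← nsmul_eq_mul]
    exact Finset.sum_le_card_nsmul _ _ _ fun j _ => hf _
  have hUb' : ∀ (q : X) (x : J → X) (i : ι),
      |(∫ p, h i p q ∂νp) - (1 / (A.card : ℝ)) * ∑ j ∈ A, h i (x j) q| ≤ 2 * M := by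
    intro q x i
    have h1 := abs_integral_le_of_abs_le (ν := νp) fun p => hM i p q
    have h2 := hmean A hA' (fun p => h i p q) (fun p => hM i p q) x
    have h3 := abs_sub (∫ p, h i p q ∂νp) ((1 / (A.card : ℝ)) * ∑ j ∈ A, h i (x j) q)
    linarith
  have hVb' : ∀ (p : X) (x : J → X) (i : ι),
      |(∫ q, h i p q ∂νm) - (1 / (C.card : ℝ)) * ∑ j ∈ C, h i p (x j)| ≤ 2 * M := by
    intro p x i
    have h1 := abs_integral_le_of_abs_le (ν := νm) fun q => hM i p q
    have h2 := hmean C hC' (fun q => h i p q) (fun q => hM i p q) x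
    have h3 := abs_sub (∫ q, h i p q ∂νm) ((1 / (C.card : ℝ)) * ∑ j ∈ C, h i p (x j))
    linarith
  have hUb : ∀ q x, |U q x| ≤ 2 * M := fun q x => abs_ciSup_le fun i => hUb' q x i
  have hVb : ∀ p x, |V p x| ≤ 2 * M := fun p x => abs_ciSup_le fun i => hVb' p x i
  have hUm' : ∀ i, Measurable fun z : X × (J → X) =>
      (∫ p, h i p z.1 ∂νp) - (1 / (A.card : ℝ)) * ∑ j ∈ A, h i (z.2 j) z.1 := by
    intro i
    refine Measurable.sub ?_ (Measurable.const_mul (Finset.measurable_sum _ fun j _ => ?_) _)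
    · have : StronglyMeasurable fun q => ∫ p, h i p q ∂νp :=
        StronglyMeasurable.integral_prod_left' (hh i).stronglyMeasurable
      exact this.measurable.comp measurable_fst
    · exact (hh i).comp (f := fun z : X × (J → X) => (z.2 j, z.1)) (by fun_prop)
  have hVm' : ∀ i, Measurable fun z : X × (J → X) =>
      (∫ q, h i z.1 q ∂νm) - (1 / (C.card : ℝ)) * ∑ j ∈ C, h i z.1 (z.2 j) := by
    intro i
    refine Measurable.sub ?_ (Measurable.const_mul (Finset.measurable_sum _ fun j _ => ?_) _)
    · have : StronglyMeasurable fun p => ∫ q, h i p q ∂νm :=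
        StronglyMeasurable.integral_prod_right' (hh i).stronglyMeasurable
      exact this.measurable.comp measurable_fst
    · exact (hh i).comp (f := fun z : X × (J → X) => (z.1, z.2 j)) (by fun_prop)
  have hUm : Measurable (Function.uncurry U) := Measurable.iSup hUm'
  have hVm : Measurable (Function.uncurry V) := Measurable.iSup hVm'
  have hUi : Integrable (Function.uncurry U) (νm.prod π) :=
    integrable_of_abs_le hUm fun z => hUb z.1 z.2
  have hVl : ∀ l, Measurable fun x : J → X => V (x l) x := fun l =>
    hVm.comp (f := fun x : J → X => (x l, x)) (by fun_prop)
  have hVli : ∀ l, Integrable (fun x : J → X => V (x l) x) π := fun l =>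
    integrable_of_abs_le (hVl l) fun x => hVb _ _
  -- pointwise decomposition
  have hpt : ∀ x : J → X, ⨆ i, ((∫ z, h i z.1 z.2 ∂(νp.prod νm)) - pairMean A C (h i) x)
      ≤ (∫ q, U q x ∂νm) + (1 / (A.card : ℝ)) * ∑ l ∈ A, V (x l) x := by
    intro x
    refine ciSup_le fun i => ?_
    have hi : Integrable (fun z : X × X => h i z.1 z.2) (νp.prod νm) :=
      integrable_of_abs_le (hh i) fun z => hM i z.1 z.2
    have hA1 : ∀ j, Integrable (fun q => h i (x j) q) νm := fun j =>
      integrable_of_abs_le (hq i _) fun q => hM i _ q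
    have e1 : (∫ z, h i z.1 z.2 ∂(νp.prod νm)) - pairMean A C (h i) x
        = (∫ q, ((∫ p, h i p q ∂νp) - (1 / (A.card : ℝ)) * ∑ j ∈ A, h i (x j) q) ∂νm)
          + (1 / (A.card : ℝ)) * ∑ l ∈ A,
            ((∫ q, h i (x l) q ∂νm) - (1 / (C.card : ℝ)) * ∑ j ∈ C, h i (x l) (x j)) := by
      have hsum : Integrable (fun q => (1 / (A.card : ℝ)) * ∑ j ∈ A, h i (x j) q) νm :=
        (integrable_finsetSum _ fun j _ => hA1 j).const_mul _
      rw [integral_sub hi.integral_prod_right hsum, integral_const_mul,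
        integral_finsetSum _ fun j _ => hA1 j, integral_prod_symm _ hi, Finset.sum_sub_distrib,
        ← Finset.mul_sum]
      unfold pairMean
      field_simp
      ring
    rw [e1]
    refine add_le_add ?_ ?_
    · refine integral_mono (integrable_of_abs_le ((hUm' i).comp measurable_prodMk_right)
        fun q => hUb' q x i) (integrable_of_abs_le (hUm.comp measurable_prodMk_right)
        fun q => hUb q x) fun q => ?_
      exact le_ciSup_finite
        (fun i => (∫ p, h i p q ∂νp) - (1 / (A.card : ℝ)) * ∑ j ∈ A, h i (x j) q) i
    · refine mul_le_mul_of_nonneg_left (Finset.sum_le_sum fun l _ => ?_) (by positivity)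
      exact le_ciSup_finite
        (fun i => (∫ q, h i (x l) q ∂νm) - (1 / (C.card : ℝ)) * ∑ j ∈ C, h i (x l) (x j)) i
  have hU : ∀ q, ∫ x, U q x ∂π ≤ 2 * R / √(A.card : ℝ) := fun q =>
    integral_ciSup_sub_mean_le Q hA hQA (fun i p => h i p q) (fun i => hp i q)
      (fun i p => hM i p q) (hRp q)
  have hV : ∀ p, ∫ x, V p x ∂π ≤ 2 * R / √(C.card : ℝ) := fun p =>
    integral_ciSup_sub_mean_le Q hC hQC (fun i q => h i p q) (fun i => hq i p)
      (fun i q => hM i p q) (hRm p)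
  -- The point `x l` with `l ∈ A` is independent of the sample over `C`.
  have hVl' : ∀ l ∈ A, ∫ x, V (x l) x ∂π ≤ 2 * R / √(C.card : ℝ) := by
    intro l hl
    have hl' : l ∉ C := Finset.disjoint_left.1 hAC hl
    have hm2 : Measurable fun z : (J → X) × (J → X) => V (z.2 l) z.1 :=
      hVm.comp (f := fun z : (J → X) × (J → X) => (z.2 l, z.1)) (by fun_prop)
    have hi2 : Integrable (fun z : (J → X) × (J → X) => V (z.2 l) z.1) (π.prod π) :=
      integrable_of_abs_le hm2 fun z => hVb _ _
    have hsw := measurePreserving_swapCoords Q (fun j => decide (j ≠ l))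
    have e1 : ∫ x, V (x l) x ∂π = ∫ z, V (z.2 l) z.1 ∂(π.prod π) := by
      have e2 : ∫ x, V (x l) x ∂π = ∫ z : (J → X) × (J → X), V (z.1 l) z.1 ∂(π.prod π) := by
        have := integral_fun_fst (μ := π) (ν := π) (fun x : J → X => V (x l) x)
        simpa using this.symm
      rw [e2]
      conv_rhs => rw [← hsw.map_eq,
        integral_map hsw.measurable.aemeasurable hm2.aestronglyMeasurable]
      congr 1; funext z
      have hV2 : ∀ p, ∀ x x' : J → X, (∀ j ∈ C, x j = x' j) → V p x = V p x' := by
        intro p x x' hx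
        simp only [V]
        congr 1; funext i
        rw [Finset.sum_congr rfl fun j hj => by rw [hx j hj]]
      simp only [swapCoords, ne_eq, not_true_eq_false, decide_false, Bool.false_eq_true, if_false]
      refine hV2 _ _ _ fun j hj => ?_
      have : j ≠ l := ne_of_mem_of_not_mem hj hl'
      simp [this]
    rw [e1, integral_prod_symm _ hi2]
    calc _ ≤ ∫ _, 2 * R / √(C.card : ℝ) ∂π :=
          integral_mono hi2.integral_prod_right (integrable_const _) fun y => hV (y l)
      _ = _ := by simp
  calc _ ≤ ∫ x, ((∫ q, U q x ∂νm) + (1 / (A.card : ℝ)) * ∑ l ∈ A, V (x l) x) ∂π := by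
        refine integral_mono ?_ ?_ hpt
        · refine integrable_of_abs_le (M := 2 * M) (Measurable.iSup fun i =>
            measurable_const.sub (measurable_pairMean A C (hh i))) fun x => ?_
          refine abs_ciSup_le fun i => ?_
          have h1 := abs_integral_le_of_abs_le (ν := νp.prod νm) fun z : X × X => hM i z.1 z.2
          have h2 := abs_pairMean_le A C hM0 (hM i) x
          have h3 := abs_sub (∫ z, h i z.1 z.2 ∂(νp.prod νm)) (pairMean A C (h i) x)
          linarith
        · exact hUi.integral_prod_right.add ((integrable_finsetSum _ fun l _ => hVli l).const_mul _)
    _ = (∫ q, ∫ x, U q x ∂π ∂νm) + (1 / (A.card : ℝ)) * ∑ l ∈ A, ∫ x, V (x l) x ∂π := by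
        have hUr : Integrable (fun x => ∫ q, U q x ∂νm) π := hUi.integral_prod_right
        rw [integral_add hUr
          ((integrable_finsetSum _ fun l _ => hVli l).const_mul _), integral_const_mul,
          integral_finsetSum _ fun l _ => hVli l]
        congr 1
        exact (integral_integral_swap hUi).symm
    _ ≤ 2 * R / √(A.card : ℝ) + (1 / (A.card : ℝ)) * (A.card * (2 * R / √(C.card : ℝ))) := by
        refine add_le_add ?_ (mul_le_mul_of_nonneg_left ?_ (by positivity))
        · calc _ ≤ ∫ _, 2 * R / √(A.card : ℝ) ∂νm :=
                integral_mono hUi.integral_prod_left (integrable_const _) hU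
            _ = _ := by simp
        · rw [← nsmul_eq_mul]
          exact Finset.sum_le_card_nsmul _ _ _ hVl'
    _ = _ := by field_simp

end TwoSample

/-! ### The bounded differences inequality -/

lemma integral_exp_sub_mean_le {X : Type*} [MeasurableSpace X] (Q : Measure X)
    [IsProbabilityMeasure Q] {f : X → ℝ} (hf : Measurable f) {c : ℝ}
    (hc : ∀ x y, f x - f y ≤ c) (s : ℝ) :
    ∫ x, Real.exp (s * (f x - ∫ y, f y ∂Q)) ∂Q ≤ Real.exp (s ^ 2 * c ^ 2 / 8) := by
  obtain ⟨x₀⟩ : Nonempty X := Q.nonempty_of_neZero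
  have hbd : BddBelow (Set.range f) := ⟨f x₀ - c, by
    rintro _ ⟨y, rfl⟩; linarith [hc x₀ y]⟩
  have hb : ∀ x, f x ∈ Set.Icc (⨅ y, f y) ((⨅ y, f y) + c) := by
    intro x
    refine ⟨ciInf_le hbd x, ?_⟩
    have : f x - c ≤ ⨅ y, f y := by
      have : Nonempty X := ⟨x₀⟩
      exact le_ciInf fun y => by linarith [hc x y]
    linarith
  have h := (hasSubgaussianMGF_of_mem_Icc hf.aemeasurable (ae_of_all Q hb)).mgf_le s
  refine h.trans (Real.exp_le_exp.2 (le_of_eq ?_))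
  simp only [add_sub_cancel_left, NNReal.coe_pow, NNReal.coe_div, coe_nnnorm, NNReal.coe_ofNat,
    Real.norm_eq_abs, div_pow, sq_abs]
  ring

/-- **McDiarmid's inequality**, at the level of the moment generating function: a function of
independent points that changes by at most `c j` when the `j`-th point is changed is sub-Gaussian
with variance proxy `∑ c_j² / 4`. -/
lemma integral_exp_bounded_differences {X : Type*} [MeasurableSpace X] (s : ℝ) :
    ∀ (n : ℕ) (Q : Fin n → Measure X) [∀ j, IsProbabilityMeasure (Q j)] (f : (Fin n → X) → ℝ)
      (_ : Measurable f) (M : ℝ) (_ : ∀ x, |f x| ≤ M) (c : Fin n → ℝ)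
      (_ : ∀ j x y, (∀ l, l ≠ j → x l = y l) → f x - f y ≤ c j),
      ∫ x, Real.exp (s * (f x - ∫ y, f y ∂(Measure.pi Q))) ∂(Measure.pi Q)
        ≤ Real.exp (s ^ 2 * (∑ j, c j ^ 2) / 8) := by
  intro n
  induction n with
  | zero =>
    intro Q _ f hf M hM c hc
    have h0 : ∀ x, f x - ∫ y, f y ∂(Measure.pi Q) = 0 := by
      intro x
      have : ∀ y, f y = f x := fun y => by rw [Subsingleton.elim y x]
      simp [this]
    simp [h0]
  | succ n ih =>
    intro Q _ f hf M hM c hc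
    set Q' : Fin n → Measure X := fun j => Q j.succ
    have hmp : MeasurePreserving (fun z : X × (Fin n → X) => (Fin.cons z.1 z.2 : Fin (n + 1) → X))
        ((Q 0).prod (Measure.pi Q')) (Measure.pi Q) := by
      have := (measurePreserving_piFinSuccAbove Q 0).symm
      convert this using 1
      · funext z; exact (Fin.insertNth_zero' z.1 z.2).symm
      · simp [Q']
    let F : X × (Fin n → X) → ℝ := fun z => f (Fin.cons z.1 z.2)
    have hF : Measurable F := hf.comp hmp.measurable
    have hFi : Integrable F ((Q 0).prod (Measure.pi Q')) := integrable_of_abs_le hF fun z => hM _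
    have htr : ∀ g : (Fin (n + 1) → X) → ℝ, Measurable g →
        ∫ x, g x ∂(Measure.pi Q) = ∫ z, g (Fin.cons z.1 z.2) ∂((Q 0).prod (Measure.pi Q')) := by
      intro g hg
      rw [← hmp.map_eq, integral_map hmp.measurable.aemeasurable hg.aestronglyMeasurable]
    -- `G` averages out the first point and inherits the remaining bounded differences.
    let G : (Fin n → X) → ℝ := fun y => ∫ x, F (x, y) ∂(Q 0)
    have hG : Measurable G :=
      (StronglyMeasurable.integral_prod_left' hF.stronglyMeasurable).measurable
    have hGM : ∀ y, |G y| ≤ M := fun y => abs_integral_le_of_abs_le fun x => hM _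
    have hsec : ∀ y, Integrable (fun x => F (x, y)) (Q 0) := fun y =>
      integrable_of_abs_le (hF.comp measurable_prodMk_right) fun x => hM _
    have hmean : ∫ y, f y ∂(Measure.pi Q) = ∫ y, G y ∂(Measure.pi Q') := by
      rw [htr f hf]; exact integral_prod_symm _ hFi
    have hGc : ∀ j x y, (∀ l, l ≠ j → x l = y l) → G x - G y ≤ c j.succ := by
      intro j x y hxy
      simp only [G]
      rw [← integral_sub (hsec x) (hsec y)]
      calc _ ≤ ∫ _, c j.succ ∂(Q 0) := by
            refine integral_mono ((hsec x).sub (hsec y)) (integrable_const _) fun u => ?_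
            refine hc j.succ _ _ fun l hl => ?_
            refine Fin.cases ?_ (fun l hl => ?_) l hl
            · intro _; rfl
            · simpa using hxy l fun h => hl (by rw [h])
        _ = _ := by simp
    set m := ∫ y, f y ∂(Measure.pi Q)
    have hexpm : Measurable fun x => Real.exp (s * (f x - m)) :=
      Real.measurable_exp.comp ((hf.sub_const _).const_mul _)
    have hexpb : ∀ v : ℝ, |v| ≤ M → ∀ m' : ℝ, |m'| ≤ M →
        |Real.exp (s * (v - m'))| ≤ Real.exp (|s| * (2 * M)) := by
      intro v hv m' hm'
      rw [abs_of_pos (Real.exp_pos _), Real.exp_le_exp]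
      refine (le_abs_self _).trans ?_
      rw [abs_mul]
      exact mul_le_mul_of_nonneg_left ((abs_sub _ _).trans (by linarith)) (abs_nonneg _)
    have hm : |m| ≤ M := abs_integral_le_of_abs_le hM
    have hEi : Integrable (fun z : X × (Fin n → X) => Real.exp (s * (F z - m)))
        ((Q 0).prod (Measure.pi Q')) :=
      integrable_of_abs_le (Real.measurable_exp.comp ((hF.sub_const _).const_mul _))
        fun z => hexpb _ (hM _) _ hm
    rw [htr _ hexpm]
    calc ∫ z, Real.exp (s * (F z - m)) ∂((Q 0).prod (Measure.pi Q'))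
        = ∫ y, ∫ x, Real.exp (s * (F (x, y) - m)) ∂(Q 0) ∂(Measure.pi Q') :=
          integral_prod_symm _ hEi
      _ ≤ ∫ y, Real.exp (s ^ 2 * c 0 ^ 2 / 8) * Real.exp (s * (G y - m)) ∂(Measure.pi Q') := by
          refine integral_mono hEi.integral_prod_right ?_ fun y => ?_
          · exact (integrable_of_abs_le (Real.measurable_exp.comp ((hG.sub_const _).const_mul _))
              fun y => hexpb _ (hGM y) _ hm).const_mul _
          · have h1 := integral_exp_sub_mean_le (Q 0) (f := fun x => F (x, y))
              (hF.comp measurable_prodMk_right) (c := c 0) (fun u v => hc 0 _ _ fun l hl => by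
                refine Fin.cases ?_ (fun l hl => ?_) l hl
                · intro h; exact absurd rfl h
                · rfl) s
            have h2 : ∀ x, Real.exp (s * (F (x, y) - m))
                = Real.exp (s * (F (x, y) - G y)) * Real.exp (s * (G y - m)) := by
              intro x; rw [← Real.exp_add]; congr 1; ring
            simp only [h2]
            rw [integral_mul_const]
            exact mul_le_mul_of_nonneg_right h1 (Real.exp_pos _).le
      _ ≤ Real.exp (s ^ 2 * c 0 ^ 2 / 8) * Real.exp (s ^ 2 * (∑ j : Fin n, c j.succ ^ 2) / 8) := by
          rw [integral_const_mul, hmean]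
          exact mul_le_mul_of_nonneg_left (ih Q' G hG M hGM _ hGc) (Real.exp_pos _).le
      _ = _ := by
          rw [← Real.exp_add, Fin.sum_univ_succ]; congr 1; ring

/-! ### Concentration of the two-sample deviation -/

section Deviation

variable {X ι : Type*} {n : ℕ}

lemma pairMean_sub_le {A C : Finset (Fin n)} (hA : A.Nonempty) (hC : C.Nonempty)
    {h : X → X → ℝ} {B : ℝ} (hB0 : 0 ≤ B) (hB : ∀ p q p' q', h p q - h p' q' ≤ 2 * B)
    (j : Fin n) {x y : Fin n → X} (hxy : ∀ l, l ≠ j → x l = y l) :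
    pairMean A C h y - pairMean A C h x
      ≤ (if j ∈ A then 2 * B / A.card else 0) + (if j ∈ C then 2 * B / C.card else 0) := by
  have hA' : (0 : ℝ) < A.card := by exact_mod_cast hA.card_pos
  have hC' : (0 : ℝ) < C.card := by exact_mod_cast hC.card_pos
  have h1 : ∀ p ∈ A, ∀ q ∈ C, h (y p) (y q) - h (x p) (x q)
      ≤ (if j = p then 2 * B else 0) + (if j = q then 2 * B else 0) := by
    intro p _ q _
    by_cases hp : j = p
    · rw [if_pos hp]
      have := hB (y p) (y q) (x p) (x q)
      have h0 : (0 : ℝ) ≤ if j = q then 2 * B else 0 := by positivity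
      linarith
    · by_cases hq : j = q
      · rw [if_neg hp, if_pos hq]
        linarith [hB (y p) (y q) (x p) (x q)]
      · rw [if_neg hp, if_neg hq, hxy p (Ne.symm hp), hxy q (Ne.symm hq)]
        simp
  have h2 := Finset.sum_le_sum fun p hp => Finset.sum_le_sum (h1 p hp)
  simp only [Finset.sum_sub_distrib, Finset.sum_add_distrib, Finset.sum_const, nsmul_eq_mul,
    Finset.sum_ite_eq, mul_ite, mul_zero] at h2
  unfold pairMean
  rw [← mul_sub, one_div, inv_mul_le_iff₀ (by positivity)]
  refine h2.trans (le_of_eq ?_)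
  split_ifs <;> field_simp <;> ring

variable [MeasurableSpace X] [Finite ι]

/-- The uniform deviation `sup_i (E h_i - Ê h_i)` of the two-sample averages over `A` and `C` of the
family `h`, for the laws `νp` and `νm`. -/
def pairDev (νp νm : Measure X) (A C : Finset (Fin n)) (h : ι → X → X → ℝ) (x : Fin n → X) : ℝ :=
  ⨆ i, ((∫ z, h i z.1 z.2 ∂(νp.prod νm)) - pairMean A C (h i) x)

lemma measurable_pairDev (νp νm : Measure X) (A C : Finset (Fin n)) {h : ι → X → X → ℝ}
    (hh : ∀ i, Measurable (Function.uncurry (h i))) : Measurable (pairDev νp νm A C h) :=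
  Measurable.iSup fun i => measurable_const.sub (measurable_pairMean A C (hh i))

variable [Nonempty ι]

lemma abs_pairDev_le (νp νm : Measure X) [IsProbabilityMeasure νp] [IsProbabilityMeasure νm]
    (A C : Finset (Fin n)) {h : ι → X → X → ℝ} {M : ℝ} (hM0 : 0 ≤ M)
    (hM : ∀ i p q, |h i p q| ≤ M) (x : Fin n → X) : |pairDev νp νm A C h x| ≤ 2 * M := by
  refine abs_ciSup_le fun i => ?_
  have h1 := abs_integral_le_of_abs_le (ν := νp.prod νm) fun z : X × X => hM i z.1 z.2
  have h2 := abs_pairMean_le A C hM0 (hM i) x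
  have h3 := abs_sub (∫ z, h i z.1 z.2 ∂(νp.prod νm)) (pairMean A C (h i) x)
  linarith

/-- The deviation, centred at its complexity bound, is sub-Gaussian with variance proxy
`B² (1/|A| + 1/|C|)`. -/
lemma integral_exp_pairDev_le (Q : Fin n → Measure X) [∀ j, IsProbabilityMeasure (Q j)]
    {A C : Finset (Fin n)} (hA : A.Nonempty) (hC : C.Nonempty) (hAC : Disjoint A C)
    {νp νm : Measure X} [IsProbabilityMeasure νp] [IsProbabilityMeasure νm]
    (hQA : ∀ j ∈ A, Q j = νp) (hQC : ∀ j ∈ C, Q j = νm)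
    (h : ι → X → X → ℝ) (hh : ∀ i, Measurable (Function.uncurry (h i))) {M : ℝ}
    (hM : ∀ i p q, |h i p q| ≤ M) {B : ℝ} (hB0 : 0 ≤ B)
    (hB : ∀ i p q p' q', h i p q - h i p' q' ≤ 2 * B) {R : ℝ}
    (hRp : ∀ q, ∀ x : Fin n → X, rad A (fun j i => h i (x j) q) ≤ R * √(A.card : ℝ))
    (hRm : ∀ p, ∀ x : Fin n → X, rad C (fun j i => h i p (x j)) ≤ R * √(C.card : ℝ))
    {s : ℝ} (hs : 0 ≤ s) :
    ∫ x, Real.exp (s * (pairDev νp νm A C h x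
        - 2 * R * (1 / √(A.card : ℝ) + 1 / √(C.card : ℝ)))) ∂(Measure.pi Q)
      ≤ Real.exp (s ^ 2 * B ^ 2 * (1 / A.card + 1 / C.card) / 2) := by
  have hA' : (0 : ℝ) < A.card := by exact_mod_cast hA.card_pos
  have hC' : (0 : ℝ) < C.card := by exact_mod_cast hC.card_pos
  obtain ⟨x₀⟩ : Nonempty X := νp.nonempty_of_neZero
  have hM0 : 0 ≤ M := (abs_nonneg _).trans (hM (Classical.arbitrary ι) x₀ x₀)
  set G := pairDev νp νm A C h with hGdef
  have hGm : Measurable G := measurable_pairDev νp νm A C hh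
  have hGb : ∀ x, |G x| ≤ 2 * M := abs_pairDev_le νp νm A C hM0 hM
  have hmean : ∫ x, G x ∂(Measure.pi Q) ≤ 2 * R * (1 / √(A.card : ℝ) + 1 / √(C.card : ℝ)) :=
    integral_ciSup_sub_pairMean_le Q hA hC hAC hQA hQC h hh hM hRp hRm
  let c : Fin n → ℝ := fun j =>
    (if j ∈ A then 2 * B / A.card else 0) + (if j ∈ C then 2 * B / C.card else 0)
  have hbd : ∀ j x y, (∀ l, l ≠ j → x l = y l) → G x - G y ≤ c j := by
    intro j x y hxy
    rw [sub_le_iff_le_add]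
    refine ciSup_le fun i => ?_
    have h1 := pairMean_sub_le hA hC hB0 (hB i) j hxy
    have h2 := le_ciSup_finite
      (fun i => (∫ z, h i z.1 z.2 ∂(νp.prod νm)) - pairMean A C (h i) y) i
    change _ ≤ G y at h2
    simp only [c]
    linarith
  have hc : ∑ j, c j ^ 2 = 4 * B ^ 2 * (1 / A.card + 1 / C.card) := by
    have h1 : ∀ j, c j ^ 2 = (if j ∈ A then (2 * B / A.card) ^ 2 else 0)
        + (if j ∈ C then (2 * B / C.card) ^ 2 else 0) := by
      intro j
      simp only [c]
      by_cases hj : j ∈ A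
      · simp [hj, Finset.disjoint_left.1 hAC hj]
      · simp [hj]
    simp only [h1, Finset.sum_add_distrib, Finset.sum_ite_mem, Finset.univ_inter,
      Finset.sum_const, nsmul_eq_mul]
    field_simp
    ring
  have hmc := integral_exp_bounded_differences s n Q G hGm (2 * M) hGb c hbd
  rw [hc] at hmc
  have hexpi : ∀ a, Integrable (fun x => Real.exp (s * (G x - a))) (Measure.pi Q) := by
    intro a
    refine integrable_of_abs_le (M := Real.exp (s * (2 * M - a)))
      (Real.measurable_exp.comp ((hGm.sub_const _).const_mul _)) fun x => ?_
    rw [abs_of_pos (Real.exp_pos _), Real.exp_le_exp]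
    exact mul_le_mul_of_nonneg_left (by linarith [(abs_le.1 (hGb x)).2]) hs
  refine (integral_mono (hexpi _) (hexpi _) fun x => ?_).trans (hmc.trans (le_of_eq ?_))
  · exact Real.exp_le_exp.2 (mul_le_mul_of_nonneg_left (by linarith) hs)
  · congr 1; ring

end Deviation

/-! ### Moments of binomial counts -/

section Binomial

variable {n : ℕ} {p q : ℝ}

lemma sum_binomial_compl (f : ℕ → ℕ → ℝ) :
    ∑ A : Finset (Fin n), f A.card (n - A.card) = ∑ A : Finset (Fin n), f (n - A.card) A.card := by
  rw [← Equiv.sum_comp (⟨compl, compl, compl_compl, compl_compl⟩ : Finset (Fin n) ≃ Finset (Fin n))]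
  refine Finset.sum_congr rfl fun A _ => ?_
  have hA : A.card ≤ n := by simpa using Finset.card_le_univ A
  simp only [Equiv.coe_fn_mk, Finset.card_compl, Fintype.card_fin]
  rw [Nat.sub_sub_self hA]

lemma sum_binomial_card (hpq : p + q = 1) :
    ∑ A : Finset (Fin n), p ^ A.card * q ^ (n - A.card) * A.card = n * p := by
  rcases n with _ | n
  · simp [Finset.eq_empty_of_isEmpty]
  have h := Finset.sum_powerset_apply_card
    (fun m => p ^ m * q ^ (n + 1 - m) * (m : ℝ)) (x := (Finset.univ : Finset (Fin (n + 1))))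
  rw [Finset.powerset_univ, Finset.card_univ, Fintype.card_fin] at h
  rw [h, Finset.sum_range_succ']
  have h2 : ∀ m ∈ Finset.range (n + 1),
      (n + 1).choose (m + 1) • (p ^ (m + 1) * q ^ (n + 1 - (m + 1)) * ((m + 1 : ℕ) : ℝ))
      = ((n + 1 : ℕ) : ℝ) * p * (p ^ m * q ^ (n - m) * (n.choose m : ℝ)) := by
    intro m _
    have h3 : ((n + 1).choose (m + 1) : ℝ) * ((m + 1 : ℕ) : ℝ)
        = ((n + 1 : ℕ) : ℝ) * n.choose m := by
      exact_mod_cast (Nat.add_one_mul_choose_eq n m).symm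
    rw [nsmul_eq_mul, Nat.succ_sub_succ]
    calc _ = ((n + 1).choose (m + 1) : ℝ) * ((m + 1 : ℕ) : ℝ) * (p ^ (m + 1) * q ^ (n - m)) := by
          ring
      _ = _ := by rw [h3]; ring
  rw [Finset.sum_congr rfl h2, ← Finset.mul_sum, ← add_pow, hpq]
  simp

/-- The inverse moment `E[1/(N+1)] ≤ 1/((n+1)p)` of a binomial count. -/
lemma sum_binomial_inv_succ (hp : 0 < p) (hq : 0 ≤ q) (hpq : p + q = 1) :
    ∑ A : Finset (Fin n), p ^ A.card * q ^ (n - A.card) * (1 / ((A.card : ℝ) + 1))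
      ≤ 1 / ((n + 1) * p) := by
  have h := Finset.sum_powerset_apply_card
    (fun m => p ^ m * q ^ (n - m) * (1 / ((m : ℝ) + 1))) (x := (Finset.univ : Finset (Fin n)))
  rw [Finset.powerset_univ, Finset.card_univ, Fintype.card_fin] at h
  rw [h, le_div_iff₀ (by positivity), Finset.sum_mul]
  have h1 := add_pow p q (n + 1)
  rw [hpq, one_pow, Finset.sum_range_succ'] at h1
  have h2 : ∀ m ∈ Finset.range (n + 1),
      n.choose m • (p ^ m * q ^ (n - m) * (1 / ((m : ℝ) + 1))) * ((n + 1) * p)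
      = p ^ (m + 1) * q ^ (n + 1 - (m + 1)) * ((n + 1).choose (m + 1) : ℝ) := by
    intro m _
    have h3 : ((n + 1).choose (m + 1) : ℝ) * ((m : ℝ) + 1) = ((n : ℝ) + 1) * n.choose m := by
      exact_mod_cast (Nat.add_one_mul_choose_eq n m).symm
    have hm : (0 : ℝ) < (m : ℝ) + 1 := by positivity
    rw [nsmul_eq_mul, Nat.succ_sub_succ]
    field_simp
    linear_combination (-(q ^ (n - m) * p ^ m * p)) * h3
  rw [Finset.sum_congr rfl h2]
  have : 0 ≤ p ^ 0 * q ^ (n + 1 - 0) * ((n + 1).choose 0 : ℝ) := by positivity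
  linarith

lemma sum_binomial_min_le (hp : 0 ≤ p) (hq : 0 ≤ q) (hpq : p + q = 1) :
    ∑ A : Finset (Fin n), p ^ A.card * q ^ (n - A.card) * (min A.card (n - A.card) : ℕ)
      ≤ 2 * n * (p * q) := by
  have h1 : ∑ A : Finset (Fin n), p ^ A.card * q ^ (n - A.card) * (min A.card (n - A.card) : ℕ)
      ≤ n * p := by
    rw [← sum_binomial_card hpq]
    gcongr
    exact min_le_left _ _
  have h2 : ∑ A : Finset (Fin n), p ^ A.card * q ^ (n - A.card) * (min A.card (n - A.card) : ℕ)
      ≤ n * q := by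
    rw [sum_binomial_compl (fun a b => p ^ a * q ^ b * (min a b : ℕ)),
      ← sum_binomial_card (p := q) (q := p) (by linarith)]
    refine Finset.sum_le_sum fun A _ => ?_
    rw [mul_comm (p ^ _)]
    gcongr
    exact min_le_right _ _
  have hn : (0 : ℝ) ≤ n := Nat.cast_nonneg n
  rcases le_total p q with h | h
  · refine h1.trans ?_
    nlinarith [mul_nonneg hn hp]
  · refine h2.trans ?_
    nlinarith [mul_nonneg hn hq]

lemma sum_binomial_inv_le (hp : 0 < p) (hq : 0 ≤ q) (hpq : p + q = 1)
    (V : Finset (Finset (Fin n))) (hV : ∀ A ∈ V, 0 < A.card) :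
    ∑ A ∈ V, p ^ A.card * q ^ (n - A.card) * ((n : ℝ) / A.card) ≤ 2 / p := by
  have h1 : ∑ A ∈ V, p ^ A.card * q ^ (n - A.card) * ((n : ℝ) / A.card)
      ≤ ∑ A ∈ V, 2 * n * (p ^ A.card * q ^ (n - A.card) * (1 / ((A.card : ℝ) + 1))) := by
    refine Finset.sum_le_sum fun A hA => ?_
    have hc : (1 : ℝ) ≤ A.card := by exact_mod_cast hV A hA
    have h2 : (n : ℝ) / A.card ≤ 2 * n * (1 / ((A.card : ℝ) + 1)) := by
      rw [mul_one_div, div_le_div_iff₀ (by positivity) (by positivity)]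
      nlinarith [Nat.cast_nonneg (α := ℝ) n]
    have h3 : 0 ≤ p ^ A.card * q ^ (n - A.card) := by positivity
    nlinarith [mul_le_mul_of_nonneg_left h2 h3]
  have h2 : ∑ A ∈ V, 2 * n * (p ^ A.card * q ^ (n - A.card) * (1 / ((A.card : ℝ) + 1)))
      ≤ ∑ A : Finset (Fin n),
          2 * n * (p ^ A.card * q ^ (n - A.card) * (1 / ((A.card : ℝ) + 1))) :=
    Finset.sum_le_sum_of_subset_of_nonneg (Finset.subset_univ _) fun A _ _ => by positivity
  refine h1.trans (h2.trans ?_)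
  rw [← Finset.mul_sum]
  refine (mul_le_mul_of_nonneg_left (sum_binomial_inv_succ hp hq hpq) (by positivity)).trans ?_
  rw [mul_one_div, div_le_div_iff₀ (by positivity) hp]
  nlinarith

/-- The second moment of the inverse imbalance of a binomial count, away from the degenerate
outcomes. -/
lemma sum_binomial_inv_min_le (hp : 0 < p) (hq : 0 < q) (hpq : p + q = 1)
    (V : Finset (Finset (Fin n))) (hV : ∀ A ∈ V, 0 < A.card ∧ A.card < n) :
    ∑ A ∈ V, p ^ A.card * q ^ (n - A.card) * ((n : ℝ) / (min A.card (n - A.card) : ℕ))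
      ≤ 2 / (p * q) := by
  have h1 : ∑ A ∈ V, p ^ A.card * q ^ (n - A.card) * ((n : ℝ) / (min A.card (n - A.card) : ℕ))
      ≤ ∑ A ∈ V, (p ^ A.card * q ^ (n - A.card) * ((n : ℝ) / A.card)
        + q ^ (n - A.card) * p ^ A.card * ((n : ℝ) / (n - A.card : ℕ))) := by
    refine Finset.sum_le_sum fun A hA => ?_
    rw [mul_comm (q ^ _), ← mul_add]
    gcongr
    rcases min_choice A.card (n - A.card) with h | h <;> rw [h]
    · exact le_add_of_nonneg_right (by positivity)
    · exact le_add_of_nonneg_left (by positivity)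
  have h2 : ∑ A ∈ V, q ^ (n - A.card) * p ^ A.card * ((n : ℝ) / (n - A.card : ℕ))
      = ∑ A ∈ V.map ⟨compl, compl_injective⟩,
          q ^ A.card * p ^ (n - A.card) * ((n : ℝ) / A.card) := by
    rw [Finset.sum_map]
    refine Finset.sum_congr rfl fun A hA => ?_
    simp only [Function.Embedding.coeFn_mk, Finset.card_compl, Fintype.card_fin]
    rw [Nat.sub_sub_self (hV A hA).2.le]
  rw [Finset.sum_add_distrib, h2] at h1
  have h3 := sum_binomial_inv_le hp hq.le hpq V fun A hA => (hV A hA).1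
  have h4 := sum_binomial_inv_le hq hp.le (by linarith) (V.map ⟨compl, compl_injective⟩) (by
    intro A hA
    obtain ⟨A', hA', rfl⟩ := Finset.mem_map.1 hA
    simp only [Function.Embedding.coeFn_mk, Finset.card_compl, Fintype.card_fin]
    have := hV A' hA'
    omega)
  have h5 : 2 / (p * q) = 2 / p + 2 / q := by
    field_simp; linarith
  linarith

end Binomial

/-! ### Conditioning on the labels of one class -/

section Pattern

lemma negIdx_eq_compl {X L : Type*} {n : ℕ} (S : Fin n → X × (L → Bool)) (k : L) :
    negIdx S k = (posIdx S k)ᶜ := by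
  ext j; simp [negIdx, posIdx]

lemma setOf_posIdx_eq {X L Ω : Type*} {n : ℕ} {D : Fin n → Ω → X × (L → Bool)} (k : L)
    (A : Finset (Fin n)) :
    {ω | posIdx (fun j => D j ω) k = A} = ⋂ j, D j ⁻¹' {z | z.2 k = decide (j ∈ A)} := by
  ext ω
  simp only [Set.mem_ofPred_eq, Set.mem_iInter, Set.mem_preimage, Finset.ext_iff, posIdx,
    Finset.mem_filter, Finset.mem_univ, true_and]
  refine forall_congr' fun j => ?_
  by_cases h : j ∈ A <;> simp [h]

variable {X L Ω : Type*} [MeasurableSpace X] [MeasurableSpace Ω]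

lemma measurableSet_label (k : L) (b : Bool) :
    MeasurableSet {z : X × (L → Bool) | z.2 k = b} :=
  measurableSet_eq_fun (by fun_prop) measurable_const

lemma isProbabilityMeasure_posLaw {P : Measure (X × (L → Bool))} [IsProbabilityMeasure P] {k : L}
    (h : P {z | z.2 k = true} ≠ 0) : IsProbabilityMeasure (posLaw P k) := by
  have := cond_isProbabilityMeasure h
  exact Measure.isProbabilityMeasure_map measurable_fst.aemeasurable

lemma isProbabilityMeasure_negLaw {P : Measure (X × (L → Bool))} [IsProbabilityMeasure P] {k : L}
    (h : P {z | z.2 k = false} ≠ 0) : IsProbabilityMeasure (negLaw P k) := by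
  have := cond_isProbabilityMeasure h
  exact Measure.isProbabilityMeasure_map measurable_fst.aemeasurable

lemma label_inter_eq {P : Measure (X × (L → Bool))} [IsProbabilityMeasure P] {k : L}
    (hp : P {z | z.2 k = true} ≠ 0) (hq : P {z | z.2 k = false} ≠ 0) (b : Bool)
    {E : Set X} (hE : MeasurableSet E) :
    P ({z | z.2 k = b} ∩ Prod.fst ⁻¹' E)
      = P {z | z.2 k = b} * (if b = true then posLaw P k else negLaw P k) E := by
  cases b
  · simp only [Bool.false_eq_true, if_false, negLaw]
    rw [Measure.map_apply measurable_fst hE, cond_apply (measurableSet_label k false),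
      ENNReal.mul_inv_cancel_left hq (measure_ne_top _ _)]
  · simp only [if_true, posLaw]
    rw [Measure.map_apply measurable_fst hE, cond_apply (measurableSet_label k true),
      ENNReal.mul_inv_cancel_left hp (measure_ne_top _ _)]

variable {μ : Measure Ω} {n : ℕ} {P : Measure (X × (L → Bool))}
  {D : Fin n → Ω → X × (L → Bool)}

lemma measurableSet_posIdx_eq (hDmeas : ∀ j, Measurable (D j)) (k : L) (A : Finset (Fin n)) :
    MeasurableSet {ω | posIdx (fun j => D j ω) k = A} := by
  rw [setOf_posIdx_eq]
  exact MeasurableSet.iInter fun j => hDmeas j (measurableSet_label k _)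

lemma measure_pattern_inter (hDmeas : ∀ j, Measurable (D j)) (hDlaw : ∀ j, μ.map (D j) = P)
    (hDindep : iIndepFun D μ) (k : L) (A : Finset (Fin n)) {E : Fin n → Set X}
    (hE : ∀ j, MeasurableSet (E j)) :
    μ ({ω | posIdx (fun j => D j ω) k = A} ∩ {ω | ∀ j, (D j ω).1 ∈ E j})
      = ∏ j, P ({z | z.2 k = decide (j ∈ A)} ∩ Prod.fst ⁻¹' (E j)) := by
  have hm : ∀ j, MeasurableSet
      ({z : X × (L → Bool) | z.2 k = decide (j ∈ A)} ∩ Prod.fst ⁻¹' (E j)) := fun j =>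
    (measurableSet_label k _).inter (measurable_fst (hE j))
  have h1 : {ω | posIdx (fun j => D j ω) k = A} ∩ {ω | ∀ j, (D j ω).1 ∈ E j}
      = ⋂ j ∈ (Finset.univ : Finset (Fin n)),
          D j ⁻¹' ({z | z.2 k = decide (j ∈ A)} ∩ Prod.fst ⁻¹' (E j)) := by
    rw [setOf_posIdx_eq]
    ext ω
    simp [forall_and]
  rw [h1, hDindep.measure_inter_preimage_eq_mul _ fun j _ => hm j]
  refine Finset.prod_congr rfl fun j _ => ?_
  rw [← hDlaw j, Measure.map_apply (hDmeas j) (hm j)]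

lemma measure_pattern (hDmeas : ∀ j, Measurable (D j)) (hDlaw : ∀ j, μ.map (D j) = P)
    (hDindep : iIndepFun D μ) (k : L) (A : Finset (Fin n)) :
    μ {ω | posIdx (fun j => D j ω) k = A}
      = ∏ j, P {z | z.2 k = decide (j ∈ A)} := by
  have := measure_pattern_inter hDmeas hDlaw hDindep k A (E := fun _ => Set.univ)
    fun _ => MeasurableSet.univ
  simpa using this

/-- The law of the instances of a sample conditioned on the positions `A` of the positive ones. -/
def patternLaw (P : Measure (X × (L → Bool))) (k : L) (A : Finset (Fin n)) (j : Fin n) :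
    Measure X :=
  if j ∈ A then posLaw P k else negLaw P k

/-- Given the positions of the positive instances of `k`, the instances are independent with laws
`P(x | y_k = 1)` and `P(x | y_k = 0)`. Conditioning on a single label keeps these two laws; the full
label vectors would not. -/
lemma setLIntegral_pattern [IsProbabilityMeasure P] (hDmeas : ∀ j, Measurable (D j))
    (hDlaw : ∀ j, μ.map (D j) = P) (hDindep : iIndepFun D μ) {k : L}
    (hp : P {z | z.2 k = true} ≠ 0) (hq : P {z | z.2 k = false} ≠ 0) (A : Finset (Fin n))
    {F : (Fin n → X) → ℝ≥0∞} (hF : Measurable F) :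
    ∫⁻ ω in {ω | posIdx (fun j => D j ω) k = A}, F (fun j => (D j ω).1) ∂μ
      = μ {ω | posIdx (fun j => D j ω) k = A}
        * ∫⁻ x, F x ∂(Measure.pi (patternLaw P k A)) := by
  have := isProbabilityMeasure_posLaw hp
  have := isProbabilityMeasure_negLaw hq
  have hpr : ∀ j, IsProbabilityMeasure (patternLaw P k A j) := fun j => by
    unfold patternLaw; split_ifs <;> infer_instance
  have hxm : Measurable fun ω j => (D j ω).1 :=
    measurable_pi_iff.2 fun j => measurable_fst.comp (hDmeas j)
  set S := {ω | posIdx (fun j => D j ω) k = A} with hS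
  have hSm : MeasurableSet S := measurableSet_posIdx_eq hDmeas k A
  have hμS := measure_pattern hDmeas hDlaw hDindep k A
  have hμ0 : μ S ≠ 0 := by
    rw [hμS]
    refine Finset.prod_ne_zero_iff.2 fun j _ => ?_
    cases decide (j ∈ A) <;> assumption
  have hμt : μ S ≠ ∞ := by
    rw [hμS]
    exact ENNReal.prod_ne_top fun j _ => measure_ne_top _ _
  have hpi : Measure.pi (patternLaw P k A)
      = (μ S)⁻¹ • (μ.restrict S).map (fun ω j => (D j ω).1) := by
    refine Measure.pi_eq fun E hE => ?_
    rw [Measure.smul_apply, Measure.map_apply hxm (MeasurableSet.univ_pi hE),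
      Measure.restrict_apply (hxm (MeasurableSet.univ_pi hE)), Set.inter_comm]
    have h1 : (fun ω j => (D j ω).1) ⁻¹' Set.univ.pi E = {ω | ∀ j, (D j ω).1 ∈ E j} := by
      ext ω; simp
    rw [h1, measure_pattern_inter hDmeas hDlaw hDindep k A hE,
      Finset.prod_congr rfl fun j _ => label_inter_eq hp hq _ (hE j), Finset.prod_mul_distrib,
      ← hμS, smul_eq_mul, ENNReal.inv_mul_cancel_left hμ0 hμt]
    simp [patternLaw]
  rw [hpi, lintegral_smul_measure, lintegral_map hF hxm, smul_eq_mul,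
    ENNReal.mul_inv_cancel_left hμ0 hμt]

lemma measureReal_pattern [IsProbabilityMeasure P] (hDmeas : ∀ j, Measurable (D j))
    (hDlaw : ∀ j, μ.map (D j) = P) (hDindep : iIndepFun D μ) (k : L) (A : Finset (Fin n)) :
    μ {ω | posIdx (fun j => D j ω) k = A}
      = ENNReal.ofReal (P.real {z | z.2 k = true} ^ A.card
          * P.real {z | z.2 k = false} ^ (n - A.card)) := by
  rw [measure_pattern hDmeas hDlaw hDindep k A]
  have h1 : ∀ j, P {z | z.2 k = decide (j ∈ A)}
      = if j ∈ A then P {z | z.2 k = true} else P {z | z.2 k = false} := by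
    intro j; by_cases h : j ∈ A <;> simp [h]
  simp_rw [h1]
  rw [Finset.prod_ite, Finset.prod_const, Finset.prod_const,
    ENNReal.ofReal_mul (by positivity), ENNReal.ofReal_pow (by positivity),
    ENNReal.ofReal_pow (by positivity), ofReal_measureReal, ofReal_measureReal]
  congr 2
  · simp
  · have : Finset.univ.filter (fun j => j ∉ A) = Aᶜ := by ext; simp
    rw [this, Finset.card_compl, Fintype.card_fin]

lemma measureReal_label_add (P : Measure (X × (L → Bool))) [IsProbabilityMeasure P] (k : L) :
    P.real {z | z.2 k = true} + P.real {z | z.2 k = false} = 1 := by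
  have h : {z : X × (L → Bool) | z.2 k = false} = {z | z.2 k = true}ᶜ := by ext; simp
  rw [h]
  simpa using measureReal_add_measureReal_compl (μ := P) (measurableSet_label k true)

end Pattern

/-! ### The one-label estimate -/

section OneLabel

variable {X ι : Type*} [MeasurableSpace X] [Finite ι] [Nonempty ι] {n : ℕ}

/-- Given the positions of the positive instances, the deviation exceeds its complexity bound
`4R s/√n` by `s T` only with a sub-Gaussian tail; `s = √(n / min(|A|, |C|))` is the square root of
the inverse imbalance and `T` the concentration level. So the positive part of `T y / 4 +
(deviation - threshold)` has mean at most a small multiple of `s`, plus `T y / 4` in case `s < y`. -/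
lemma lintegral_excess_le (Q : Fin n → Measure X) [∀ j, IsProbabilityMeasure (Q j)]
    {A C : Finset (Fin n)} (hA : A.Nonempty) (hC : C.Nonempty) (hAC : Disjoint A C)
    {νp νm : Measure X} [IsProbabilityMeasure νp] [IsProbabilityMeasure νm]
    (hQA : ∀ j ∈ A, Q j = νp) (hQC : ∀ j ∈ C, Q j = νm)
    (h : ι → X → X → ℝ) (hh : ∀ i, Measurable (Function.uncurry (h i))) {M : ℝ}
    (hM : ∀ i p q, |h i p q| ≤ M) {B : ℝ} (hB0 : 0 < B)
    (hB : ∀ i p q p' q', h i p q - h i p' q' ≤ 2 * B) {R : ℝ} (hR : 0 ≤ R)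
    (hRp : ∀ q, ∀ x : Fin n → X, rad A (fun j i => h i (x j) q) ≤ R * √(A.card : ℝ))
    (hRm : ∀ p, ∀ x : Fin n → X, rad C (fun j i => h i p (x j)) ≤ R * √(C.card : ℝ))
    {s : ℝ} (hs : s = √((n : ℝ) / (min A.card C.card : ℕ))) {T ℓ y : ℝ} (hT : 0 < T)
    (hTℓ : T ^ 2 = 18 * ℓ * (B ^ 2 / n)) (hℓ : 0 ≤ ℓ) (hy : 0 < y) :
    ∫⁻ x, ENNReal.ofReal (T * y / 4 + (pairDev νp νm A C h x - s * (4 * R / √(n : ℝ) + T)))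
        ∂(Measure.pi Q)
      ≤ ENNReal.ofReal ((if s < y then T * y / 4 else 0)
        + 8 * (B ^ 2 / n) / (3 * T) * Real.exp (-(2 * ℓ)) * s) := by
  have hA' : (0 : ℝ) < A.card := by exact_mod_cast hA.card_pos
  have hC' : (0 : ℝ) < C.card := by exact_mod_cast hC.card_pos
  have hn : (0 : ℝ) < n := by
    obtain ⟨j, -⟩ := hA
    exact_mod_cast j.pos
  obtain ⟨x₀⟩ : Nonempty X := νp.nonempty_of_neZero
  have hM0 : 0 ≤ M := (abs_nonneg _).trans (hM (Classical.arbitrary ι) x₀ x₀)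
  have hmin : (0 : ℝ) < (min A.card C.card : ℕ) := by
    exact_mod_cast lt_min hA.card_pos hC.card_pos
  have hs0 : 0 < s := by rw [hs]; positivity
  have hs2 : s ^ 2 = n / (min A.card C.card : ℕ) := by
    rw [hs, Real.sq_sqrt (by positivity)]
  -- both reciprocal counts are at most `s² / n`
  have hrec : ∀ S : Finset (Fin n), (min A.card C.card : ℕ) ≤ S.card →
      1 / (S.card : ℝ) ≤ s ^ 2 / n := by
    intro S hS
    have hS' : ((min A.card C.card : ℕ) : ℝ) ≤ S.card := by exact_mod_cast hS
    rw [hs2, div_div_cancel_left' hn.ne', ← one_div]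
    exact one_div_le_one_div_of_le hmin hS'
  have hsq : ∀ S : Finset (Fin n), (min A.card C.card : ℕ) ≤ S.card →
      1 / √(S.card : ℝ) ≤ s / √(n : ℝ) := by
    intro S hS
    have := Real.sqrt_le_sqrt (hrec S hS)
    rwa [Real.sqrt_div zero_le_one, Real.sqrt_one, Real.sqrt_div (sq_nonneg s),
      Real.sqrt_sq hs0.le] at this
  set κ2 := B ^ 2 / (n : ℝ) with hκ2
  have hκ0 : 0 < κ2 := by positivity
  set e := s * (4 * R / √(n : ℝ)) with he
  have hcomp : 2 * R * (1 / √(A.card : ℝ) + 1 / √(C.card : ℝ)) ≤ e := by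
    have h1 := hsq A (min_le_left _ _)
    have h2 := hsq C (min_le_right _ _)
    have : e = 2 * R * (s / √(n : ℝ) + s / √(n : ℝ)) := by rw [he]; ring
    rw [this]
    exact mul_le_mul_of_nonneg_left (add_le_add h1 h2) (by positivity)
  set G := pairDev νp νm A C h
  have hGm : Measurable G := measurable_pairDev νp νm A C hh
  have hGb : ∀ x, |G x| ≤ 2 * M := abs_pairDev_le νp νm A C hM0 hM
  -- `v` minimises the exponent `v² κ2 s² - (3/4) v s T` of the resulting bound
  set v := 3 * T / (8 * κ2 * s) with hv
  have hv0 : 0 < v := by positivity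
  have hexpi : ∀ a, Integrable (fun x => Real.exp (v * (G x - a))) (Measure.pi Q) := by
    intro a
    refine integrable_of_abs_le (M := Real.exp (v * (2 * M - a)))
      (Real.measurable_exp.comp ((hGm.sub_const _).const_mul _)) fun x => ?_
    rw [abs_of_pos (Real.exp_pos _), Real.exp_le_exp]
    exact mul_le_mul_of_nonneg_left (by linarith [(abs_le.1 (hGb x)).2]) hv0.le
  have hmgf : ∫ x, Real.exp (v * (G x - e)) ∂(Measure.pi Q) ≤ Real.exp (v ^ 2 * κ2 * s ^ 2) := by
    have h1 := integral_exp_pairDev_le Q hA hC hAC hQA hQC h hh hM hB0.le hB hRp hRm hv0.le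
    refine (integral_mono (hexpi _) (hexpi _) fun x => ?_).trans (h1.trans ?_)
    · exact Real.exp_le_exp.2 (mul_le_mul_of_nonneg_left (sub_le_sub_left hcomp _) hv0.le)
    · rw [Real.exp_le_exp]
      have h2 := add_le_add (hrec A (min_le_left _ _)) (hrec C (min_le_right _ _))
      have h3 := mul_le_mul_of_nonneg_left h2 (by positivity : 0 ≤ v ^ 2 * B ^ 2 / 2)
      calc _ = v ^ 2 * B ^ 2 / 2 * (1 / A.card + 1 / C.card) := by ring
        _ ≤ _ := h3
        _ = _ := by rw [hκ2]; ring
  set I := if s < y then T * y / 4 else 0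
  have hI0 : 0 ≤ I := by simp only [I]; positivity
  have hpt : ∀ x, T * y / 4 + (G x - s * (4 * R / √(n : ℝ) + T))
      ≤ I + 1 / v * Real.exp (-(v * (3 / 4 * (s * T)))) * Real.exp (v * (G x - e)) := by
    intro x
    have h1 : G x - e - 3 / 4 * (s * T)
        ≤ 1 / v * Real.exp (-(v * (3 / 4 * (s * T)))) * Real.exp (v * (G x - e)) := by
      rw [mul_assoc, ← Real.exp_add, one_div, le_inv_mul_iff₀ hv0]
      refine le_trans ?_ (Real.add_one_le_exp _)
      linarith
    have h2 : s * (4 * R / √(n : ℝ) + T) = e + s * T := by rw [he]; ring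
    rw [h2]
    have hsT : 0 ≤ s * T := by positivity
    by_cases hsy : s < y
    · simp only [I, if_pos hsy]; linarith
    · simp only [I, if_neg hsy]
      have : T * y ≤ s * T := by
        rw [mul_comm]; exact mul_le_mul_of_nonneg_right (not_lt.1 hsy) hT.le
      linarith
  have hint : Integrable (fun x => I + 1 / v * Real.exp (-(v * (3 / 4 * (s * T))))
      * Real.exp (v * (G x - e))) (Measure.pi Q) :=
    (integrable_const _).add ((hexpi e).const_mul _)
  calc _ ≤ ∫⁻ x, ENNReal.ofReal (I + 1 / v * Real.exp (-(v * (3 / 4 * (s * T))))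
      * Real.exp (v * (G x - e))) ∂(Measure.pi Q) :=
        lintegral_mono fun x => ENNReal.ofReal_le_ofReal (hpt x)
    _ = ENNReal.ofReal (∫ x, (I + 1 / v * Real.exp (-(v * (3 / 4 * (s * T))))
      * Real.exp (v * (G x - e))) ∂(Measure.pi Q)) :=
        (ofReal_integral_eq_lintegral_ofReal hint (ae_of_all _ fun x => by
          simp only [Pi.zero_apply]; positivity)).symm
    _ ≤ _ := by
        refine ENNReal.ofReal_le_ofReal ?_
        rw [integral_add (integrable_const _) ((hexpi e).const_mul _), integral_const_mul]
        simp only [integral_const, probReal_univ, one_smul]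
        refine add_le_add_right ?_ _
        have h1 : 1 / v = 8 * κ2 / (3 * T) * s := by rw [hv]; field_simp
        have h2 : Real.exp (-(v * (3 / 4 * (s * T)))) * Real.exp (v ^ 2 * κ2 * s ^ 2)
            ≤ Real.exp (-(2 * ℓ)) := by
          rw [← Real.exp_add, Real.exp_le_exp]
          have h3 : v * (s * T) = 3 * T ^ 2 / (8 * κ2) := by rw [hv]; field_simp
          have h4 : v ^ 2 * κ2 * s ^ 2 = 9 * T ^ 2 / (64 * κ2) := by rw [hv]; field_simp; ring
          have h5 : T ^ 2 / κ2 = 18 * ℓ := by rw [hTℓ]; field_simp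
          have h6 : 3 * T ^ 2 / (8 * κ2) = 3 / 8 * (T ^ 2 / κ2) := by field_simp
          have h7 : 9 * T ^ 2 / (64 * κ2) = 9 / 64 * (T ^ 2 / κ2) := by field_simp
          rw [show v * (3 / 4 * (s * T)) = 3 / 4 * (v * (s * T)) by ring, h3, h4, h6, h7, h5]
          linarith
        calc _ ≤ 1 / v * Real.exp (-(v * (3 / 4 * (s * T)))) * Real.exp (v ^ 2 * κ2 * s ^ 2) :=
              mul_le_mul_of_nonneg_left hmgf (by positivity)
          _ = 1 / v * (Real.exp (-(v * (3 / 4 * (s * T)))) * Real.exp (v ^ 2 * κ2 * s ^ 2)) := by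
              ring
          _ ≤ 1 / v * Real.exp (-(2 * ℓ)) := mul_le_mul_of_nonneg_left h2 (by positivity)
          _ = _ := by rw [h1]; ring

end OneLabel

section OneLabelSample

variable {X L Ω : Type*} {n : ℕ} {D : Fin n → Ω → X × (L → Bool)}

/-- Both classes of the label `k` occur in the sample. -/
def seenSet (D : Fin n → Ω → X × (L → Bool)) (k : L) : Set Ω :=
  {ω | (posIdx (fun j => D j ω) k).Nonempty ∧ (negIdx (fun j => D j ω) k).Nonempty}

/-- The positions of the positive instances for which both classes occur. -/
def seenPatterns (n : ℕ) : Finset (Finset (Fin n)) :=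
  Finset.univ.filter fun A => A.Nonempty ∧ Aᶜ.Nonempty

lemma seenSet_eq_iUnion (k : L) :
    seenSet D k = ⋃ A ∈ seenPatterns n, {ω | posIdx (fun j => D j ω) k = A} := by
  ext ω
  simp [seenSet, seenPatterns, negIdx_eq_compl]

variable [MeasurableSpace X] [MeasurableSpace Ω] {μ : Measure Ω} {P : Measure (X × (L → Bool))}

lemma measure_seenSet_eq_zero (hDmeas : ∀ j, Measurable (D j)) (hDlaw : ∀ j, μ.map (D j) = P)
    {k : L} (h : P {z | z.2 k = true} = 0 ∨ P {z | z.2 k = false} = 0) :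
    μ (seenSet D k) = 0 := by
  have key : ∀ b, P {z | z.2 k = b} = 0 → μ (⋃ j, D j ⁻¹' {z | z.2 k = b}) = 0 := by
    intro b hb
    refine measure_iUnion_null fun j => ?_
    rw [← Measure.map_apply (hDmeas j) (measurableSet_label k b), hDlaw j, hb]
  rcases h with h | h
  · refine measure_mono_null ?_ (key true h)
    rintro ω ⟨⟨j, hj⟩, -⟩
    exact Set.mem_iUnion.2 ⟨j, by simpa [posIdx] using hj⟩
  · refine measure_mono_null ?_ (key false h)
    rintro ω ⟨-, ⟨j, hj⟩⟩
    exact Set.mem_iUnion.2 ⟨j, by simpa [negIdx] using hj⟩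

/-- The deviation of the two-sample averages of the label `k` on a random sample, minus the
threshold `τ_k^{-1/2} (4R/√n + T)`. -/
def excess {ι : Type*} (P : Measure (X × (L → Bool))) (D : Fin n → Ω → X × (L → Bool)) (k : L)
    (h : ι → X → X → ℝ) (c : ℝ) (ω : Ω) : ℝ :=
  pairDev (posLaw P k) (negLaw P k) (posIdx (fun j => D j ω) k) (negIdx (fun j => D j ω) k) h
      (fun j => (D j ω).1)
    - √(1 / imbalance (fun j => D j ω) k) * c

/-- The one-label estimate: relative to a level `b` proportional to a lower quantile of
`τ_k^{-1/2}`, the excess has small positive part in the mean. Such a first moment bound, unlike a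
tail bound, can be added up over labels and tasks that depend on each other arbitrarily. -/
lemma exists_lintegral_excess_le [IsProbabilityMeasure P] {ι : Type*} [Finite ι] [Nonempty ι]
    (hDmeas : ∀ j, Measurable (D j)) (hDlaw : ∀ j, μ.map (D j) = P) (hDindep : iIndepFun D μ)
    (k : L) (h : ι → X → X → ℝ) (hh : ∀ i, Measurable (Function.uncurry (h i))) {M : ℝ}
    (hM : ∀ i p q, |h i p q| ≤ M) {B : ℝ} (hB0 : 0 < B)
    (hB : ∀ i p q p' q', h i p q - h i p' q' ≤ 2 * B) {R : ℝ} (hR : 0 ≤ R)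
    (hRp : ∀ A q, ∀ x : Fin n → X, rad A (fun j i => h i (x j) q) ≤ R * √(A.card : ℝ))
    (hRm : ∀ A p, ∀ x : Fin n → X, rad A (fun j i => h i p (x j)) ≤ R * √(A.card : ℝ))
    {δ : ℝ} (hδ : 0 < δ) (hδ1 : δ ≤ 1) :
    ∃ b > 0, ∫⁻ ω in seenSet D k, ENNReal.ofReal (b + excess P D k h
      (4 * R / √(n : ℝ) + 6 * B * √(Real.log (6 / δ) / (2 * n))) ω) ∂μ
        ≤ ENNReal.ofReal (δ * b) := by
  by_cases hp : P {z | z.2 k = true} = 0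
  · exact ⟨1, one_pos, by
      rw [setLIntegral_measure_zero _ _ (measure_seenSet_eq_zero hDmeas hDlaw (Or.inl hp))]
      exact zero_le⟩
  by_cases hq : P {z | z.2 k = false} = 0
  · exact ⟨1, one_pos, by
      rw [setLIntegral_measure_zero _ _ (measure_seenSet_eq_zero hDmeas hDlaw (Or.inr hq))]
      exact zero_le⟩
  rcases Nat.eq_zero_or_pos n with rfl | hn
  · refine ⟨1, one_pos, ?_⟩
    have : seenSet D k = ∅ := by
      ext ω; simp [seenSet, Finset.eq_empty_of_isEmpty]
    simp [this]
  have hn' : (0 : ℝ) < n := by exact_mod_cast hn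
  have := isProbabilityMeasure_posLaw hp
  have := isProbabilityMeasure_negLaw hq
  have hpr : ∀ A : Finset (Fin n), ∀ j, IsProbabilityMeasure (patternLaw P k A j) := fun A j => by
    unfold patternLaw; split_ifs <;> infer_instance
  set p := P.real {z | z.2 k = true} with hpdef
  set q := P.real {z | z.2 k = false} with hqdef
  have hp0 : 0 < p := ENNReal.toReal_pos hp (measure_ne_top _ _)
  have hq0 : 0 < q := ENNReal.toReal_pos hq (measure_ne_top _ _)
  have hpq : p + q = 1 := measureReal_label_add P k
  set ℓ := Real.log (6 / δ) with hℓ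
  have hℓ1 : 1 ≤ ℓ := by
    rw [hℓ, Real.le_log_iff_exp_le (by positivity)]
    have h6 : (6 : ℝ) ≤ 6 / δ := by rw [le_div_iff₀ hδ]; linarith
    linarith [Real.exp_one_lt_d9]
  set T := 6 * B * √(ℓ / (2 * n)) with hTdef
  have hT : 0 < T := by positivity
  have hTℓ : T ^ 2 = 18 * ℓ * (B ^ 2 / n) := by
    rw [hTdef, mul_pow, Real.sq_sqrt (by positivity)]; field_simp; ring
  have hexp : Real.exp (-(2 * ℓ)) = δ ^ 2 / 36 := by
    rw [show -(2 * ℓ) = -ℓ + -ℓ by ring, Real.exp_add, Real.exp_neg, hℓ,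
      Real.exp_log (by positivity)]
    field_simp; norm_num
  -- With probability at most `δ / 2` both classes occur and `τ_k^{-1/2} < y`.
  set y := √(δ / (4 * (p * q))) with hydef
  have hy : 0 < y := by positivity
  have hy2 : y ^ 2 * (p * q) = δ / 4 := by
    rw [hydef, Real.sq_sqrt (by positivity)]; field_simp
  set c := 4 * R / √(n : ℝ) + T with hc
  set b := T * y / 4 with hb
  have hb0 : 0 < b := by positivity
  refine ⟨b, hb0, ?_⟩
  let s : Finset (Fin n) → ℝ := fun A => √((n : ℝ) / (min A.card (n - A.card) : ℕ))
  let w : Finset (Fin n) → ℝ := fun A => p ^ A.card * q ^ (n - A.card)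
  have hw : ∀ A, 0 ≤ w A := fun A => by positivity
  set K := 8 * (B ^ 2 / n) / (3 * T) * Real.exp (-(2 * ℓ)) with hK
  have hK0 : 0 ≤ K := by positivity
  have hV : ∀ A ∈ seenPatterns n, 0 < A.card ∧ A.card < n := by
    intro A hA
    obtain ⟨h1, h2⟩ := (Finset.mem_filter.1 hA).2
    have h3 := h2.card_pos
    rw [Finset.card_compl, Fintype.card_fin] at h3
    exact ⟨h1.card_pos, by omega⟩
  have hpat : ∀ A ∈ seenPatterns n,
      ∫⁻ ω in {ω | posIdx (fun j => D j ω) k = A}, ENNReal.ofReal (b + excess P D k h c ω) ∂μ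
        ≤ ENNReal.ofReal (w A * ((if s A < y then b else 0) + K * s A)) := by
    intro A hA
    obtain ⟨hA1, hA2⟩ := (Finset.mem_filter.1 hA).2
    have e1 : ∫⁻ ω in {ω | posIdx (fun j => D j ω) k = A},
        ENNReal.ofReal (b + excess P D k h c ω) ∂μ
        = ∫⁻ ω in {ω | posIdx (fun j => D j ω) k = A},
          (fun x => ENNReal.ofReal (b + (pairDev (posLaw P k) (negLaw P k) A Aᶜ h x - s A * c)))
            (fun j => (D j ω).1) ∂μ := by
      refine setLIntegral_congr_fun (measurableSet_posIdx_eq hDmeas k A) fun ω hω => ?_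
      have hω' : posIdx (fun j => D j ω) k = A := hω
      simp only [excess, imbalance, negIdx_eq_compl, hω', s, one_div_div, Finset.card_compl,
        Fintype.card_fin]
    have hFm : Measurable fun x : Fin n → X => ENNReal.ofReal
        (b + (pairDev (posLaw P k) (negLaw P k) A Aᶜ h x - s A * c)) :=
      (((measurable_pairDev _ _ A Aᶜ hh).sub_const _).const_add _).ennreal_ofReal
    rw [e1, setLIntegral_pattern hDmeas hDlaw hDindep hp hq A hFm,
      measureReal_pattern hDmeas hDlaw hDindep k A, ENNReal.ofReal_mul (hw A)]
    refine mul_le_mul_right ?_ _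
    refine lintegral_excess_le (patternLaw P k A) hA1 hA2 disjoint_compl_right
      (fun j hj => by simp [patternLaw, hj])
      (fun j hj => by simp [patternLaw, Finset.mem_compl.1 hj]) h hh hM hB0 hB hR
      (hRp A) (hRm Aᶜ) ?_ hT hTℓ (by linarith) hy
    simp only [s, Finset.card_compl, Fintype.card_fin]
  have hreal : ∑ A ∈ seenPatterns n, w A * ((if s A < y then b else 0) + K * s A) ≤ δ * b := by
    have hs2 : ∀ A, s A ^ 2 = (n : ℝ) / (min A.card (n - A.card) : ℕ) := fun A =>
      Real.sq_sqrt (by positivity)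
    have h1 : ∑ A ∈ seenPatterns n, w A * (if s A < y then b else 0) ≤ δ / 2 * b := by
      calc _ ≤ ∑ A ∈ seenPatterns n, b * (y ^ 2 / n) * (w A * (min A.card (n - A.card) : ℕ)) := by
            refine Finset.sum_le_sum fun A hA => ?_
            have hm : (0 : ℝ) < (min A.card (n - A.card) : ℕ) := by
              have := hV A hA
              exact_mod_cast lt_min this.1 (by omega)
            split_ifs with hsy
            · have h2 : s A ^ 2 ≤ y ^ 2 := pow_le_pow_left₀ (Real.sqrt_nonneg _) hsy.le 2
              rw [hs2, div_le_iff₀ hm] at h2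
              have h3 : 1 ≤ y ^ 2 / n * (min A.card (n - A.card) : ℕ) := by
                rw [div_mul_eq_mul_div, le_div_iff₀ hn']; linarith
              calc w A * b = b * w A * 1 := by ring
                _ ≤ b * w A * (y ^ 2 / n * (min A.card (n - A.card) : ℕ)) :=
                  mul_le_mul_of_nonneg_left h3 (mul_nonneg hb0.le (hw A))
                _ = _ := by ring
            · rw [mul_zero]
              have := hw A
              positivity
        _ ≤ b * (y ^ 2 / n) * (2 * n * (p * q)) := by
            rw [← Finset.mul_sum]
            refine mul_le_mul_of_nonneg_left ?_ (by positivity)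
            exact (Finset.sum_le_sum_of_subset_of_nonneg (Finset.subset_univ _) fun A _ _ =>
              mul_nonneg (hw A) (Nat.cast_nonneg _)).trans
              (sum_binomial_min_le hp0.le hq0.le hpq)
        _ = b * (2 * (y ^ 2 * (p * q))) := by field_simp
        _ = _ := by rw [hy2]; ring
    have h2 : ∑ A ∈ seenPatterns n, w A * s A ≤ 9 / 2 * (y / δ) := by
      have hw1 : ∑ A ∈ seenPatterns n, w A ≤ 1 := by
        have h3 : ∑ A : Finset (Fin n), w A = 1 := by
          rw [Fin.sum_pow_mul_eq_add_pow, hpq, one_pow]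
        rw [← h3]
        exact Finset.sum_le_sum_of_subset_of_nonneg (Finset.subset_univ _) fun A _ _ => hw A
      have hinv := sum_binomial_inv_min_le hp0 hq0 hpq (seenPatterns n) hV
      have hy3 : 2 / (p * q) = 8 * y ^ 2 / δ := by
        field_simp; linarith
      calc _ ≤ ∑ A ∈ seenPatterns n, (y / 2 * w A
              + 1 / (2 * y) * (w A * ((n : ℝ) / (min A.card (n - A.card) : ℕ)))) := by
            refine Finset.sum_le_sum fun A _ => ?_
            have h4 : s A ≤ y / 2 + 1 / (2 * y) * s A ^ 2 := by
              have : y / 2 + 1 / (2 * y) * s A ^ 2 - s A = (s A - y) ^ 2 / (2 * y) := by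
                field_simp; ring
              have h5 : 0 ≤ (s A - y) ^ 2 / (2 * y) := by positivity
              linarith
            rw [hs2] at h4
            calc _ ≤ w A * (y / 2 + 1 / (2 * y) * ((n : ℝ) / (min A.card (n - A.card) : ℕ))) :=
                  mul_le_mul_of_nonneg_left h4 (hw A)
              _ = _ := by ring
        _ ≤ y / 2 * 1 + 1 / (2 * y) * (8 * y ^ 2 / δ) := by
            rw [Finset.sum_add_distrib, ← Finset.mul_sum, ← Finset.mul_sum, ← hy3]
            exact add_le_add (mul_le_mul_of_nonneg_left hw1 (by positivity))
              (mul_le_mul_of_nonneg_left hinv (by positivity))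
        _ = y / 2 + 4 * (y / δ) := by field_simp; ring
        _ ≤ _ := by
            have : y ≤ y / δ := by rw [le_div_iff₀ hδ]; nlinarith
            linarith
    have h3 : K * (9 / 2 * (y / δ)) ≤ δ / 2 * b := by
      have h4 : B ^ 2 / n = T ^ 2 / (18 * ℓ) := by rw [hTℓ]; field_simp
      have h5 : K * (9 / 2 * (y / δ)) = δ * T * y / 54 * (1 / ℓ) := by
        rw [hK, hexp, h4]; field_simp; ring
      rw [h5]
      have h6 : 1 / ℓ ≤ 1 := by rw [div_le_one (by linarith)]; exact hℓ1
      have h7 : 0 ≤ δ * T * y := by positivity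
      calc _ ≤ δ * T * y / 54 * 1 := mul_le_mul_of_nonneg_left h6 (by positivity)
        _ ≤ _ := by rw [hb]; linarith
    calc _ = ∑ A ∈ seenPatterns n, w A * (if s A < y then b else 0)
          + K * ∑ A ∈ seenPatterns n, w A * s A := by
          rw [Finset.mul_sum, ← Finset.sum_add_distrib]
          exact Finset.sum_congr rfl fun A _ => by ring
      _ ≤ δ / 2 * b + δ / 2 * b :=
          add_le_add h1 ((mul_le_mul_of_nonneg_left h2 hK0).trans h3)
      _ = _ := by ring
  rw [seenSet_eq_iUnion, lintegral_biUnion_finset (fun A _ A' _ hne => by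
      refine Set.disjoint_left.2 fun ω h1 h2 => hne ?_
      have h1' : posIdx (fun j => D j ω) k = A := h1
      have h2' : posIdx (fun j => D j ω) k = A' := h2
      rw [← h1', h2']) fun A _ => measurableSet_posIdx_eq hDmeas k A]
  refine (Finset.sum_le_sum hpat).trans ?_
  rw [← ENNReal.ofReal_sum_of_nonneg fun A _ => by
    have := hw A
    have : 0 ≤ s A := Real.sqrt_nonneg _
    positivity]
  exact ENNReal.ofReal_le_ofReal hreal

end OneLabelSample

/-! ### From first moments to a joint high-probability bound -/

section Markov

variable {Ω : Type*} [MeasurableSpace Ω] {μ : Measure Ω}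

/-- First moment bounds relative to the levels `b m` add up: a weighted sum of arbitrarily dependent
variables `Y m` is positive with probability at most `δ`, because this forces the weighted sum of
the positive parts of `b m + Y m` above the weighted sum of the levels. -/
lemma measure_weighted_sum_pos_le {I : Type*} [Fintype I] {c : I → ℝ} (hc : ∀ m, 0 ≤ c m)
    {Y : I → Ω → ℝ} (hY : ∀ m, Measurable (Y m)) {S : I → Set Ω} (hS : ∀ m, MeasurableSet (S m))
    {δ : ℝ} (hδ : 0 < δ)
    (h : ∀ m, ∃ b > 0, ∫⁻ ω in S m, ENNReal.ofReal (b + Y m ω) ∂μ ≤ ENNReal.ofReal (δ * b)) :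
    μ {ω | (∀ m, c m ≠ 0 → ω ∈ S m) ∧ 0 < ∑ m, c m * Y m ω} ≤ ENNReal.ofReal δ := by
  choose b hb hbound using h
  set s := ∑ m, c m * b m with hs
  have hs0 : 0 ≤ s := Finset.sum_nonneg fun m _ => mul_nonneg (hc m) (hb m).le
  rcases hs0.eq_or_lt with hs1 | hs1
  · have hc0 : ∀ m, c m = 0 := by
      intro m
      have := (Finset.sum_eq_zero_iff_of_nonneg fun m _ => mul_nonneg (hc m) (hb m).le).1
        hs1.symm m (Finset.mem_univ m)
      exact (mul_eq_zero.1 this).resolve_right (hb m).ne'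
    simp [hc0]
  let W : Ω → ℝ≥0∞ := fun ω =>
    ∑ m, ENNReal.ofReal (c m) * (S m).indicator (fun ω => ENNReal.ofReal (b m + Y m ω)) ω
  have hWt : ∀ m, Measurable fun ω =>
      ENNReal.ofReal (c m) * (S m).indicator (fun ω => ENNReal.ofReal (b m + Y m ω)) ω := fun m =>
    ((((hY m).const_add _).ennreal_ofReal).indicator (hS m)).const_mul _
  have hW : Measurable W := Finset.measurable_sum _ fun m _ => hWt m
  have hWint : ∫⁻ ω, W ω ∂μ ≤ ENNReal.ofReal (δ * s) := by
    simp only [W]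
    rw [lintegral_finsetSum _ fun m _ => hWt m, hs, Finset.mul_sum,
      ENNReal.ofReal_sum_of_nonneg fun m _ =>
        mul_nonneg hδ.le (mul_nonneg (hc m) (hb m).le)]
    refine Finset.sum_le_sum fun m _ => ?_
    rw [lintegral_const_mul _ (((hY m).const_add _).ennreal_ofReal.indicator (hS m)),
      lintegral_indicator (hS m), show δ * (c m * b m) = c m * (δ * b m) by ring,
      ENNReal.ofReal_mul (hc m)]
    exact mul_le_mul_right (hbound m) _
  have hsub : {ω | (∀ m, c m ≠ 0 → ω ∈ S m) ∧ 0 < ∑ m, c m * Y m ω}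
      ⊆ {ω | ENNReal.ofReal s ≤ W ω} := by
    rintro ω ⟨hω, hpos⟩
    have h1 : s ≤ ∑ m, c m * max (b m + Y m ω) 0 := by
      have h2 : ∑ m, c m * (b m + Y m ω) ≤ ∑ m, c m * max (b m + Y m ω) 0 :=
        Finset.sum_le_sum fun m _ => mul_le_mul_of_nonneg_left (le_max_left _ _) (hc m)
      simp only [mul_add, Finset.sum_add_distrib] at h2
      linarith
    refine (ENNReal.ofReal_le_ofReal h1).trans ?_
    rw [ENNReal.ofReal_sum_of_nonneg fun m _ => mul_nonneg (hc m) (le_max_right _ _)]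
    refine Finset.sum_le_sum fun m _ => ?_
    rw [ENNReal.ofReal_mul (hc m)]
    by_cases hm : c m = 0
    · simp [hm]
    · rw [Set.indicator_of_mem (hω m hm), ENNReal.ofReal_max, ENNReal.ofReal_zero,
        max_eq_left zero_le]
  refine (measure_mono hsub).trans
    ((meas_ge_le_lintegral_div hW.aemeasurable (ENNReal.ofReal_pos.2 hs1).ne'
      ENNReal.ofReal_ne_top).trans ?_)
  refine (ENNReal.div_le_div_right hWint _).trans ?_
  rw [← ENNReal.ofReal_div_of_pos hs1, mul_div_cancel_right₀ _ hs1.ne']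

end Markov

section Measurability

variable {X L Ω : Type*} [MeasurableSpace X] [MeasurableSpace Ω] {n : ℕ}
  {D : Fin n → Ω → X × (L → Bool)}

lemma measurableSet_seenSet (hDmeas : ∀ j, Measurable (D j)) (k : L) :
    MeasurableSet (seenSet D k) := by
  rw [seenSet_eq_iUnion]
  exact Finset.measurableSet_biUnion _ fun A _ => measurableSet_posIdx_eq hDmeas k A

lemma measurable_excess (hDmeas : ∀ j, Measurable (D j)) (P : Measure (X × (L → Bool))) (k : L)
    {ι : Type*} [Finite ι] {h : ι → X → X → ℝ} (hh : ∀ i, Measurable (Function.uncurry (h i)))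
    (c : ℝ) : Measurable (excess P D k h c) := by
  have hxm : Measurable fun ω j => (D j ω).1 :=
    measurable_pi_iff.2 fun j => measurable_fst.comp (hDmeas j)
  have : excess P D k h c = fun ω => ∑ A : Finset (Fin n),
      {ω | posIdx (fun j => D j ω) k = A}.indicator (fun ω =>
        pairDev (posLaw P k) (negLaw P k) A Aᶜ h (fun j => (D j ω).1)
          - √(1 / (((min A.card Aᶜ.card : ℕ) : ℝ) / (n : ℝ))) * c) ω := by
    funext ω
    rw [Finset.sum_eq_single (posIdx (fun j => D j ω) k)]
    · simp [excess, imbalance, negIdx_eq_compl]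
    · intro A _ hA
      exact Set.indicator_of_notMem (fun h => hA h.symm) _
    · simp
  rw [this]
  refine Finset.measurable_sum _ fun A _ => Measurable.indicator ?_
    (measurableSet_posIdx_eq hDmeas k A)
  exact ((measurable_pairDev _ _ A Aᶜ hh).comp hxm).sub_const _

end Measurability

/-! ### The margin losses of kernel scores -/

section Loss

lemma hinge_nonneg (z : ℝ) : 0 ≤ hinge z := le_max_left _ _

lemma abs_hinge_sub_le (z z' : ℝ) : |hinge z - hinge z'| ≤ |z - z'| := by
  unfold hinge
  refine (abs_max_sub_max_le_max _ _ _ _).trans ?_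
  rw [sub_self, abs_zero, sub_sub_sub_cancel_left, abs_sub_comm z' z]
  exact max_le (abs_nonneg _) le_rfl

lemma measurable_hinge : Measurable hinge := by
  unfold hinge; fun_prop

/-- The three kinds of deviations that have to be controlled: risk above empirical risk, expected
gap above empirical gap, and empirical gap above expected gap. -/
inductive DevKind
  | risk
  | gap
  | negGap

instance : Fintype DevKind where
  elems := ⟨[DevKind.risk, DevKind.gap, DevKind.negGap], by simp⟩
  complete := by intro κ; cases κ <;> simp

lemma DevKind.sum_eq (f : DevKind → ℝ) :
    ∑ κ, f κ = f DevKind.risk + f DevKind.gap + f DevKind.negGap := by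
  change (Multiset.map f _).sum = _
  simp [Finset.univ, Fintype.elems]
  ring

/-- The quantity whose deviation is considered, as a function of the losses `a`, `b` of two
hypotheses. -/
def DevKind.apply : DevKind → ℝ → ℝ → ℝ
  | .risk, a, _ => a
  | .gap, a, b => |a - b|
  | .negGap, a, b => -|a - b|

/-- The number of hypotheses that enter a deviation. -/
def DevKind.arity : DevKind → ℝ
  | .risk => 1
  | .gap => 2
  | .negGap => 2

lemma DevKind.arity_pos (κ : DevKind) : 0 < κ.arity := by cases κ <;> norm_num [DevKind.arity]

lemma DevKind.abs_apply_sub_le (κ : DevKind) (a b a' b' : ℝ) :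
    |κ.apply a b - κ.apply a' b'| ≤ |a - a'| + |b - b'| := by
  have h : |(|a - b| - |a' - b'|)| ≤ |a - a'| + |b - b'| := by
    refine (abs_abs_sub_abs_le _ _).trans ?_
    rw [show a - b - (a' - b') = (a - a') - (b - b') by ring]
    exact abs_sub _ _
  cases κ
  · simp only [DevKind.apply]; linarith [abs_nonneg (b - b')]
  · exact h
  · simp only [DevKind.apply]
    rwa [neg_sub_neg, abs_sub_comm]

lemma DevKind.abs_apply_le (κ : DevKind) {a b B : ℝ} (ha : 0 ≤ a) (ha' : a ≤ B) (hb : 0 ≤ b)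
    (hb' : b ≤ B) : |κ.apply a b| ≤ B := by
  cases κ <;> simp only [DevKind.apply, abs_neg, abs_abs] <;> rw [abs_le] <;> constructor <;>
    linarith

lemma DevKind.apply_sub_le (κ : DevKind) {a b a' b' B : ℝ} (ha : 0 ≤ a) (ha' : a ≤ B) (hb : 0 ≤ b)
    (hb' : b ≤ B) (hc : 0 ≤ a') (hc' : a' ≤ B) (hd : 0 ≤ b') (hd' : b' ≤ B) :
    κ.apply a b - κ.apply a' b' ≤ B := by
  have h1 : |a - b| ≤ B := by rw [abs_le]; constructor <;> linarith
  have h2 : |a' - b'| ≤ B := by rw [abs_le]; constructor <;> linarith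
  have h3 := abs_nonneg (a - b)
  have h4 := abs_nonneg (a' - b')
  cases κ <;> simp only [DevKind.apply] <;> linarith

lemma DevKind.measurable_apply (κ : DevKind) : Measurable fun z : ℝ × ℝ => κ.apply z.1 z.2 := by
  cases κ <;> simp only [DevKind.apply]
  · exact measurable_fst
  · exact (measurable_fst.sub measurable_snd).abs
  · exact (measurable_fst.sub measurable_snd).abs.neg

variable {X : Type*}

lemma rldamLoss_nonneg (Δp Δm : ℝ) (g : X → ℝ) (p q : X) : 0 ≤ rldamLoss Δp Δm g p q :=
  add_nonneg (hinge_nonneg _) (hinge_nonneg _)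

lemma abs_rldamLoss_sub_le (Δp Δm : ℝ) {g g' : X → ℝ} {η : ℝ} (h : ∀ x, |g x - g' x| ≤ η)
    (p q : X) : |rldamLoss Δp Δm g p q - rldamLoss Δp Δm g' p q| ≤ 2 * η := by
  unfold rldamLoss
  have h1 := (abs_hinge_sub_le (g p - Δp) (g' p - Δp)).trans (by simpa using h p)
  have h2 : |hinge (-g q - Δm) - hinge (-g' q - Δm)| ≤ η :=
    (abs_hinge_sub_le _ _).trans
      (by rw [sub_sub_sub_cancel_right, neg_sub_neg, abs_sub_comm]; exact h q)
  rw [add_sub_add_comm]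
  exact (abs_add_le _ _).trans (by linarith)

/-- The function of a pair of instances whose two-sample averages are compared. -/
def pairKernel (κ : DevKind) (Δp Δm : ℝ) (g g' : X → ℝ) (p q : X) : ℝ :=
  κ.apply (rldamLoss Δp Δm g p q) (rldamLoss Δp Δm g' p q)

lemma abs_pairKernel_sub_le (κ : DevKind) (Δp Δm : ℝ) {g g' f f' : X → ℝ} {η : ℝ}
    (h : ∀ x, |g x - f x| ≤ η) (h' : ∀ x, |g' x - f' x| ≤ η) (p q : X) :
    |pairKernel κ Δp Δm g g' p q - pairKernel κ Δp Δm f f' p q| ≤ 4 * η :=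
  (κ.abs_apply_sub_le _ _ _ _).trans (by
    linarith [abs_rldamLoss_sub_le Δp Δm h p q, abs_rldamLoss_sub_le Δp Δm h' p q])

lemma measurable_rldamLoss [MeasurableSpace X] (Δp Δm : ℝ) {g : X → ℝ} (hg : Measurable g) :
    Measurable fun z : X × X => rldamLoss Δp Δm g z.1 z.2 :=
  (measurable_hinge.comp ((hg.comp measurable_fst).sub_const _)).add
    (measurable_hinge.comp ((hg.comp measurable_snd).neg.sub_const _))

lemma measurable_pairKernel [MeasurableSpace X] (κ : DevKind) (Δp Δm : ℝ) {g g' : X → ℝ}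
    (hg : Measurable g) (hg' : Measurable g') :
    Measurable (Function.uncurry (pairKernel κ Δp Δm g g')) :=
  κ.measurable_apply.comp ((measurable_rldamLoss Δp Δm hg).prodMk (measurable_rldamLoss Δp Δm hg'))

/-- The margin losses of a score function are at most `B`. -/
def LossBounded (Δp Δm B : ℝ) (g : X → ℝ) : Prop :=
  ∀ x, hinge (g x - Δp) ≤ B ∧ hinge (-(g x) - Δm) ≤ B

lemma LossBounded.rldamLoss_le {Δp Δm B : ℝ} {g : X → ℝ} (h : LossBounded Δp Δm B g) (p q : X) :
    rldamLoss Δp Δm g p q ≤ 2 * B := by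
  unfold rldamLoss; linarith [(h p).1, (h q).2]

lemma abs_pairKernel_le {κ : DevKind} {Δp Δm B : ℝ} {g g' : X → ℝ} (h : LossBounded Δp Δm B g)
    (h' : LossBounded Δp Δm B g') (p q : X) : |pairKernel κ Δp Δm g g' p q| ≤ 2 * B :=
  κ.abs_apply_le (rldamLoss_nonneg _ _ _ _ _) (h.rldamLoss_le p q) (rldamLoss_nonneg _ _ _ _ _)
    (h'.rldamLoss_le p q)

variable {H J ι : Type*} [NormedAddCommGroup H] [InnerProductSpace ℝ H]
  [Fintype J] [DecidableEq J] [Finite ι] [Nonempty ι]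

section RadLoss

variable {Φ : X → H} {Λ r : ℝ}

/-- By contraction, the moving summand of the loss and the one frozen at `q` each contribute the
Rademacher average of the scores. -/
lemma rad_rldamLoss_fst_le (hr : 0 ≤ r) (hΦ : ∀ x, ‖Φ x‖ ≤ r) (Δp Δm : ℝ) {w : ι → H}
    (hw : ∀ i, ‖w i‖ ≤ Λ) (A : Finset J) (q : X) (x : J → X) :
    rad A (fun j i => rldamLoss Δp Δm (fun x => ⟪w i, Φ x⟫) (x j) q)
      ≤ 2 * Λ * r * √(A.card : ℝ) := by
  unfold rldamLoss
  refine (rad_add_le A (fun j i => hinge (⟪w i, Φ (x j)⟫ - Δp))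
    (fun _ i => hinge (-⟪w i, Φ q⟫ - Δm))).trans ?_
  have h1 := (rad_contract A (fun j i => hinge (⟪w i, Φ (x j)⟫ - Δp))
    (fun j i => ⟪w i, Φ (x j)⟫) fun j _ i i' =>
      (abs_hinge_sub_le _ _).trans (by rw [sub_sub_sub_cancel_right])).trans
    (rad_inner_le A w (fun j => Φ (x j)) hr hw fun j => hΦ _)
  have h2 := (rad_contract A (fun _ i => hinge (-⟪w i, Φ q⟫ - Δm))
    (fun _ i => ⟪w i, Φ q⟫) fun j _ i i' =>
      (abs_hinge_sub_le _ _).trans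
        (by rw [sub_sub_sub_cancel_right, neg_sub_neg, abs_sub_comm])).trans
    (rad_inner_le A w (fun _ => Φ q) hr hw fun j => hΦ _)
  linarith

lemma rad_rldamLoss_snd_le (hr : 0 ≤ r) (hΦ : ∀ x, ‖Φ x‖ ≤ r) (Δp Δm : ℝ) {w : ι → H}
    (hw : ∀ i, ‖w i‖ ≤ Λ) (A : Finset J) (p : X) (x : J → X) :
    rad A (fun j i => rldamLoss Δp Δm (fun x => ⟪w i, Φ x⟫) p (x j))
      ≤ 2 * Λ * r * √(A.card : ℝ) := by
  unfold rldamLoss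
  refine (rad_add_le A (fun _ i => hinge (⟪w i, Φ p⟫ - Δp))
    (fun j i => hinge (-⟪w i, Φ (x j)⟫ - Δm))).trans ?_
  have h1 := (rad_contract A (fun _ i => hinge (⟪w i, Φ p⟫ - Δp))
    (fun _ i => ⟪w i, Φ p⟫) fun j _ i i' =>
      (abs_hinge_sub_le _ _).trans (by rw [sub_sub_sub_cancel_right])).trans
    (rad_inner_le A w (fun _ => Φ p) hr hw fun j => hΦ _)
  have h2 := (rad_contract A (fun j i => hinge (-⟪w i, Φ (x j)⟫ - Δm))
    (fun j i => ⟪w i, Φ (x j)⟫) fun j _ i i' =>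
      (abs_hinge_sub_le _ _).trans
        (by rw [sub_sub_sub_cancel_right, neg_sub_neg, abs_sub_comm])).trans
    (rad_inner_le A w (fun j => Φ (x j)) hr hw fun j => hΦ _)
  linarith

end RadLoss

lemma rad_apply_le (κ : DevKind) (A : Finset J) {a b : J → ι → ℝ} {R : ℝ}
    (ha : rad A a ≤ R) (hb : rad A b ≤ R) :
    rad A (fun j i => κ.apply (a j i) (b j i)) ≤ κ.arity * R := by
  have h : rad A (fun j i => a j i + -b j i) ≤ 2 * R := by
    have := rad_add_le A a (fun j i => -b j i)
    rw [rad_neg] at this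
    linarith
  cases κ
  · simpa [DevKind.apply, DevKind.arity] using ha
  · refine (rad_contract A _ _ fun j _ i i' => ?_).trans h
    simpa [DevKind.apply, sub_eq_add_neg] using abs_abs_sub_abs_le (a j i - b j i) (a j i' - b j i')
  · refine (rad_contract A _ _ fun j _ i i' => ?_).trans h
    simp only [DevKind.apply]
    rw [neg_sub_neg, abs_sub_comm]
    simpa [sub_eq_add_neg] using abs_abs_sub_abs_le (a j i - b j i) (a j i' - b j i')

end Loss

/-! ### A countable dense family of hypotheses -/

/-- The scores of the ball of radius `Λ` are uniformly approximated, relative to `‖Φ x‖`, by those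
of a sequence in the ball. `H` itself need not be separable; only the closed span of the separable
range of `Φ` matters, by orthogonal projection. -/
lemma exists_dense_scores {X H : Type*} [MeasurableSpace X] [NormedAddCommGroup H]
    [InnerProductSpace ℝ H] [CompleteSpace H] {Φ : X → H} (hΦ : StronglyMeasurable Φ) {Λ : ℝ}
    (hΛ : 0 ≤ Λ) :
    ∃ w : ℕ → H, (∀ m, ‖w m‖ ≤ Λ) ∧ ∀ u, ‖u‖ ≤ Λ → ∀ η > 0, ∃ m, ∀ x,
      |⟪u, Φ x⟫ - ⟪w m, Φ x⟫| ≤ η * ‖Φ x‖ := by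
  set V : Submodule ℝ H := (Submodule.span ℝ (Set.range Φ)).topologicalClosure with hV
  have hVc : IsClosed (V : Set H) := Submodule.isClosed_topologicalClosure _
  have : CompleteSpace V := hVc.completeSpace_coe
  have hsep : TopologicalSpace.IsSeparable ((V : Set H) ∩ {u | ‖u‖ ≤ Λ}) := by
    have h1 : TopologicalSpace.IsSeparable (V : Set H) := by
      rw [hV, Submodule.topologicalClosure_coe]
      exact (hΦ.isSeparable_range.span (R := ℝ)).closure
    exact h1.mono Set.inter_subset_left
  obtain ⟨c, hcs, hcc, hcd⟩ := hsep.exists_countable_dense_subset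
  have h0 : (0 : H) ∈ (V : Set H) ∩ {u | ‖u‖ ≤ Λ} := ⟨V.zero_mem, by simpa using hΛ⟩
  have hcne : c.Nonempty := closure_nonempty_iff.1 ⟨0, hcd h0⟩
  obtain ⟨w, rfl⟩ := hcc.exists_eq_range hcne
  refine ⟨w, fun m => (hcs ⟨m, rfl⟩).2, fun u hu η hη => ?_⟩
  set v : H := V.starProjection u with hv
  have hvV : v ∈ (V : Set H) ∩ {u | ‖u‖ ≤ Λ} :=
    ⟨Submodule.starProjection_apply_mem V u, (Submodule.norm_starProjection_apply_le V u).trans hu⟩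
  obtain ⟨_, ⟨m, rfl⟩, hm⟩ := Metric.mem_closure_iff.1 (hcd hvV) η hη
  refine ⟨m, fun x => ?_⟩
  have hx : Φ x ∈ V := Submodule.le_topologicalClosure _ (Submodule.subset_span ⟨x, rfl⟩)
  have h1 : ⟪u, Φ x⟫ = ⟪v, Φ x⟫ := by
    have := Submodule.starProjection_inner_eq_zero u (Φ x) hx
    rw [inner_sub_left] at this
    linarith
  rw [h1, ← inner_sub_left]
  refine (abs_real_inner_le_norm _ _).trans (mul_le_mul_of_nonneg_right ?_ (norm_nonneg _))
  rw [← dist_eq_norm]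
  exact hm.le

/-! ### Uniform deviations of all labels and tasks -/

section PairLaw

variable {X L : Type*} [MeasurableSpace X] (P : Measure (X × (L → Bool))) (k : L)

instance : IsZeroOrProbabilityMeasure (posLaw P k) := by unfold posLaw; infer_instance

instance : IsZeroOrProbabilityMeasure (negLaw P k) := by unfold negLaw; infer_instance

/-- The law of a pair of a positive and a negative instance; the zero measure if one of the two
classes is null. -/
def pairLaw : Measure (X × X) := (posLaw P k).prod (negLaw P k)

instance : IsFiniteMeasure (pairLaw P k) := by unfold pairLaw; infer_instance

lemma pairLaw_real_univ_le : (pairLaw P k).real Set.univ ≤ 1 := by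
  refine ENNReal.toReal_le_of_le_ofReal zero_le_one ?_
  rw [pairLaw, ← Set.univ_prod_univ, Measure.prod_prod, ENNReal.ofReal_one]
  exact mul_le_one' prob_le_one prob_le_one

lemma abs_integral_pairLaw_le {f : X × X → ℝ} {c : ℝ} (hc : 0 ≤ c) (h : ∀ z, |f z| ≤ c) :
    |∫ z, f z ∂(pairLaw P k)| ≤ c := by
  have h1 := norm_integral_le_of_norm_le_const (μ := pairLaw P k) (f := f) (ae_of_all _ h)
  exact h1.trans (mul_le_of_le_one_right hc (pairLaw_real_univ_le P k))

end PairLaw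

section Event

variable {X L Ω : Type*} [MeasurableSpace X]

/-- The deviation of the two-sample average of one pair function from its mean, for the label
`k`. -/
def sampleDev {n : ℕ} (P : Measure (X × (L → Bool))) (S : Fin n → X × (L → Bool)) (k : L)
    (h : X → X → ℝ) : ℝ :=
  (∫ z, h z.1 z.2 ∂(pairLaw P k)) - pairMean (posIdx S k) (negIdx S k) h (fun j => (S j).1)

lemma sampleDev_le_add {n : ℕ} (P : Measure (X × (L → Bool))) (S : Fin n → X × (L → Bool)) (k : L)
    {h h' : X → X → ℝ} (hm : Measurable (Function.uncurry h))
    (hm' : Measurable (Function.uncurry h'))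
    {M : ℝ} (hM : ∀ p q, |h p q| ≤ M) (hM' : ∀ p q, |h' p q| ≤ M) {c : ℝ} (hc : 0 ≤ c)
    (hhh : ∀ p q, |h p q - h' p q| ≤ c) :
    sampleDev P S k h ≤ sampleDev P S k h' + 2 * c := by
  have h1 := abs_integral_pairLaw_le P k hc fun z : X × X => hhh z.1 z.2
  have hi : Integrable (fun z : X × X => h z.1 z.2) (pairLaw P k) :=
    integrable_of_abs_le hm fun z => hM z.1 z.2
  have hi' : Integrable (fun z : X × X => h' z.1 z.2) (pairLaw P k) :=
    integrable_of_abs_le hm' fun z => hM' z.1 z.2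
  rw [integral_sub hi hi'] at h1
  have h2 := abs_pairMean_le (posIdx S k) (negIdx S k) (h := fun p q => h p q - h' p q) hc hhh
    (fun j => (S j).1)
  have h3 : pairMean (posIdx S k) (negIdx S k) (fun p q => h p q - h' p q) (fun j => (S j).1)
      = pairMean (posIdx S k) (negIdx S k) h (fun j => (S j).1)
        - pairMean (posIdx S k) (negIdx S k) h' (fun j => (S j).1) := by
    simp only [pairMean, Finset.sum_sub_distrib, mul_sub]
  rw [h3] at h2
  unfold sampleDev
  linarith [(abs_le.1 h1).2, (abs_le.1 h2).1]

/-- The threshold that the deviation of kind `κ` of a label has to meet. -/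
def devThreshold {n : ℕ} (S : Fin n → X × (L → Bool)) (k : L) (κ : DevKind) (Λ r B δ : ℝ) : ℝ :=
  √(1 / imbalance S k) * (4 * (κ.arity * (2 * Λ * r)) / √(n : ℝ)
    + 6 * B * √(Real.log (6 / δ) / (2 * n)))

end Event

/-- With probability `1 - δ`, a fixed nonnegative combination of all deviations stays below the
same combination of thresholds, uniformly over the hypotheses. No union bound over labels and tasks
is involved, so the confidence level `δ` does not have to be shared among them. -/
lemma exists_event_weighted_dev_le {X H Ω I : Type*} [MeasurableSpace X] [NormedAddCommGroup H]
    [InnerProductSpace ℝ H] [CompleteSpace H] [MeasurableSpace Ω] {μ : Measure Ω}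
    [IsProbabilityMeasure μ] [Fintype I] {L : I → Type*} [∀ i, Fintype (L i)]
    (P : (i : I) → Measure (X × (L i → Bool))) [∀ i, IsProbabilityMeasure (P i)] {n : I → ℕ}
    {D : (i : I) → Fin (n i) → Ω → X × (L i → Bool)} (hDmeas : ∀ i j, Measurable (D i j))
    (hDlaw : ∀ i j, μ.map (D i j) = P i) (hDindep : ∀ i, iIndepFun (D i) μ)
    {Φ : X → H} (hΦ : StronglyMeasurable Φ) {r : I → ℝ} (hr : ∀ i, 0 ≤ r i)
    (hΦr : ∀ i x, ‖Φ x‖ ≤ r i) {Λ : ℝ} (hΛ : 0 ≤ Λ) (Δp Δm : (i : I) → L i → ℝ) {B : ℝ}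
    (hB0 : 0 < B) (hB : ∀ u : H, ‖u‖ ≤ Λ → ∀ i k,
      LossBounded (Δp i k) (Δm i k) B (fun x => ⟪u, Φ x⟫))
    {a : I → DevKind → ℝ} (ha : ∀ i κ, 0 ≤ a i κ) {δ : ℝ} (hδ : 0 < δ) (hδ1 : δ ≤ 1) :
    ∃ E : Set Ω, MeasurableSet E ∧ ENNReal.ofReal (1 - δ) ≤ μ E ∧ ∀ ω ∈ E,
      (∀ i, (∃ κ, a i κ ≠ 0) → AllLabelsSeen fun j => D i j ω) →
      ∀ u v : (i : I) → L i → H, (∀ i k, ‖u i k‖ ≤ Λ) → (∀ i k, ‖v i k‖ ≤ Λ) →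
        ∑ m : (i : I) × (L i × DevKind), a m.1 m.2.2 *
          (sampleDev (P m.1) (fun j => D m.1 j ω) m.2.1
              (pairKernel m.2.2 (Δp m.1 m.2.1) (Δm m.1 m.2.1) (fun x => ⟪u m.1 m.2.1, Φ x⟫)
                (fun x => ⟪v m.1 m.2.1, Φ x⟫))
            - devThreshold (fun j => D m.1 j ω) m.2.1 m.2.2 Λ (r m.1) B δ) ≤ 0 := by
  obtain ⟨w, hwΛ, hwd⟩ := exists_dense_scores hΦ hΛ
  have hscore : ∀ u : H, Measurable fun x => (⟪u, Φ x⟫ : ℝ) := fun u =>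
    (stronglyMeasurable_const.inner hΦ).measurable
  -- The hypotheses are exhausted by finite families, pairs of the first `N + 1` scores.
  let h : ∀ (N : ℕ) (m : (i : I) × (L i × DevKind)), Fin (N + 1) × Fin (N + 1) → X → X → ℝ :=
    fun N m z => pairKernel m.2.2 (Δp m.1 m.2.1) (Δm m.1 m.2.1) (fun x => ⟪w z.1, Φ x⟫)
      (fun x => ⟪w z.2, Φ x⟫)
  let c : (i : I) × (L i × DevKind) → ℝ := fun m =>
    4 * (m.2.2.arity * (2 * Λ * r m.1)) / √(n m.1 : ℝ)
      + 6 * B * √(Real.log (6 / δ) / (2 * n m.1))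
  let Y : ℕ → (i : I) × (L i × DevKind) → Ω → ℝ := fun N m =>
    excess (P m.1) (D m.1) m.2.1 (h N m) (c m)
  have hhm : ∀ N m z, Measurable (Function.uncurry (h N m z)) := fun N m z =>
    measurable_pairKernel _ _ _ (hscore _) (hscore _)
  have hYm : ∀ N m, Measurable (Y N m) := fun N m =>
    measurable_excess (hDmeas m.1) _ _ (hhm N m) _
  have hSm : ∀ m : (i : I) × (L i × DevKind), MeasurableSet (seenSet (D m.1) m.2.1) := fun m =>
    measurableSet_seenSet (hDmeas m.1) _
  have hlb : ∀ N m, ∃ b > 0, ∫⁻ ω in seenSet (D m.1) m.2.1, ENNReal.ofReal (b + Y N m ω) ∂μ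
      ≤ ENNReal.ofReal (δ * b) := by
    intro N m
    have hR : 0 ≤ m.2.2.arity * (2 * Λ * r m.1) := by
      have := hr m.1
      have := m.2.2.arity_pos
      positivity
    refine exists_lintegral_excess_le (hDmeas m.1) (hDlaw m.1) (hDindep m.1) m.2.1 (h N m)
      (hhm N m) (M := 2 * B) ?_ hB0 ?_ hR ?_ ?_ hδ hδ1
    · exact fun z p q => abs_pairKernel_le (hB _ (hwΛ _) _ _) (hB _ (hwΛ _) _ _) p q
    · intro z p q p' q'
      have h1 := hB _ (hwΛ z.1) m.1 m.2.1
      have h2 := hB _ (hwΛ z.2) m.1 m.2.1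
      exact m.2.2.apply_sub_le (rldamLoss_nonneg _ _ _ _ _) (h1.rldamLoss_le p q)
        (rldamLoss_nonneg _ _ _ _ _) (h2.rldamLoss_le p q) (rldamLoss_nonneg _ _ _ _ _)
        (h1.rldamLoss_le p' q') (rldamLoss_nonneg _ _ _ _ _) (h2.rldamLoss_le p' q')
    · intro A q x
      rw [mul_assoc]
      exact rad_apply_le m.2.2 A
        (rad_rldamLoss_fst_le (hr m.1) (hΦr m.1) _ _
          (w := fun z : Fin (N + 1) × Fin (N + 1) => w z.1) (fun z => hwΛ _) A q x)
        (rad_rldamLoss_fst_le (hr m.1) (hΦr m.1) _ _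
          (w := fun z : Fin (N + 1) × Fin (N + 1) => w z.2) (fun z => hwΛ _) A q x)
    · intro A p x
      rw [mul_assoc]
      exact rad_apply_le m.2.2 A
        (rad_rldamLoss_snd_le (hr m.1) (hΦr m.1) _ _
          (w := fun z : Fin (N + 1) × Fin (N + 1) => w z.1) (fun z => hwΛ _) A p x)
        (rad_rldamLoss_snd_le (hr m.1) (hΦr m.1) _ _
          (w := fun z : Fin (N + 1) × Fin (N + 1) => w z.2) (fun z => hwΛ _) A p x)
  let bad : ℕ → Set Ω := fun N => {ω |
    (∀ m : (i : I) × (L i × DevKind), a m.1 m.2.2 ≠ 0 → ω ∈ seenSet (D m.1) m.2.1) ∧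
      0 < ∑ m, a m.1 m.2.2 * Y N m ω}
  have hbadμ : ∀ N, μ (bad N) ≤ ENNReal.ofReal δ := fun N =>
    measure_weighted_sum_pos_le (fun m => ha m.1 m.2.2) (hYm N) hSm hδ (hlb N)
  have hbadm : ∀ N, MeasurableSet (bad N) := by
    intro N
    have h1 : bad N = (⋂ m : (i : I) × (L i × DevKind), ⋂ _ : a m.1 m.2.2 ≠ 0,
        seenSet (D m.1) m.2.1) ∩ {ω | 0 < ∑ m, a m.1 m.2.2 * Y N m ω} := by
      ext ω; simp [bad]
    rw [h1]
    have : Countable ((i : I) × (L i × DevKind)) := Finite.to_countable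
    exact (MeasurableSet.iInter fun m => MeasurableSet.iInter fun _ => hSm m).inter
      (measurableSet_lt measurable_const
        (Finset.measurable_sum _ fun m _ => (hYm N m).const_mul _))
  have hmono : Monotone bad := by
    intro N N' hN ω hω
    refine ⟨hω.1, hω.2.trans_le (Finset.sum_le_sum fun m _ =>
      mul_le_mul_of_nonneg_left (sub_le_sub_right (ciSup_le fun z => ?_) _) (ha _ _))⟩
    exact le_ciSup_finite (fun z => (∫ y, h N' m z y.1 y.2 ∂(posLaw (P m.1) m.2.1).prod
      (negLaw (P m.1) m.2.1)) - pairMean _ _ (h N' m z) _)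
      (Fin.castLE (by omega) z.1, Fin.castLE (by omega) z.2)
  refine ⟨(⋃ N, bad N)ᶜ, (MeasurableSet.iUnion hbadm).compl, ?_, ?_⟩
  · rw [prob_compl_eq_one_sub (MeasurableSet.iUnion hbadm), hmono.measure_iUnion,
      ENNReal.ofReal_sub _ hδ.le, ENNReal.ofReal_one]
    exact tsub_le_tsub_left (iSup_le hbadμ) _
  intro ω hω hseen u v hu hv
  refine le_of_forall_pos_le_add fun ε hε => ?_
  set Ctot := ∑ m : (i : I) × (L i × DevKind), a m.1 m.2.2 * (8 * r m.1) with hCtot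
  have hC0 : 0 ≤ Ctot := Finset.sum_nonneg fun m _ => mul_nonneg (ha _ _) (by linarith [hr m.1])
  set η := ε / (Ctot + 1) with hη
  have hη0 : 0 < η := by positivity
  choose m₁ hm₁ using fun m : (i : I) × (L i × DevKind) => hwd (u m.1 m.2.1) (hu _ _) η hη0
  choose m₂ hm₂ using fun m : (i : I) × (L i × DevKind) => hwd (v m.1 m.2.1) (hv _ _) η hη0
  set N := Finset.univ.sup m₁ + Finset.univ.sup m₂ with hN
  have hN₁ : ∀ m, m₁ m < N + 1 := fun m => by
    have := Finset.le_sup (f := m₁) (Finset.mem_univ m); omega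
  have hN₂ : ∀ m, m₂ m < N + 1 := fun m => by
    have := Finset.le_sup (f := m₂) (Finset.mem_univ m); omega
  have hgood : ∑ m, a m.1 m.2.2 * Y N m ω ≤ 0 := by
    by_contra hcon
    refine hω (Set.mem_iUnion.2 ⟨N, fun m hm => ?_, not_le.1 hcon⟩)
    exact hseen m.1 ⟨m.2.2, hm⟩ m.2.1
  have hitem : ∀ m : (i : I) × (L i × DevKind), sampleDev (P m.1) (fun j => D m.1 j ω) m.2.1
              (pairKernel m.2.2 (Δp m.1 m.2.1) (Δm m.1 m.2.1) (fun x => ⟪u m.1 m.2.1, Φ x⟫)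
                (fun x => ⟪v m.1 m.2.1, Φ x⟫))
            - devThreshold (fun j => D m.1 j ω) m.2.1 m.2.2 Λ (r m.1) B δ
      ≤ Y N m ω + η * (8 * r m.1) := by
    intro m
    have h1 := sampleDev_le_add (P m.1) (fun j => D m.1 j ω) m.2.1
      (h := pairKernel m.2.2 (Δp m.1 m.2.1) (Δm m.1 m.2.1) (fun x => ⟪u m.1 m.2.1, Φ x⟫)
        (fun x => ⟪v m.1 m.2.1, Φ x⟫))
      (h' := h N m (⟨m₁ m, hN₁ m⟩, ⟨m₂ m, hN₂ m⟩))
      (measurable_pairKernel _ _ _ (hscore _) (hscore _)) (hhm _ _ _)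
      (abs_pairKernel_le (hB _ (hu _ _) _ _) (hB _ (hv _ _) _ _))
      (abs_pairKernel_le (hB _ (hwΛ _) _ _) (hB _ (hwΛ _) _ _))
      (c := 4 * (η * r m.1)) (by have := hr m.1; positivity)
      (abs_pairKernel_sub_le _ _ _
        (fun x => (hm₁ m x).trans (mul_le_mul_of_nonneg_left (hΦr _ x) hη0.le))
        (fun x => (hm₂ m x).trans (mul_le_mul_of_nonneg_left (hΦr _ x) hη0.le)))
    have h2 := le_ciSup_finite (fun z => sampleDev (P m.1) (fun j => D m.1 j ω) m.2.1 (h N m z))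
      (⟨m₁ m, hN₁ m⟩, ⟨m₂ m, hN₂ m⟩)
    have h3 : Y N m ω = (⨆ z, sampleDev (P m.1) (fun j => D m.1 j ω) m.2.1 (h N m z))
        - devThreshold (fun j => D m.1 j ω) m.2.1 m.2.2 Λ (r m.1) B δ := rfl
    rw [h3]
    linarith
  calc _ ≤ ∑ m : (i : I) × (L i × DevKind), a m.1 m.2.2 * (Y N m ω + η * (8 * r m.1)) :=
        Finset.sum_le_sum fun m _ => mul_le_mul_of_nonneg_left (hitem m) (ha _ _)
    _ = (∑ m, a m.1 m.2.2 * Y N m ω) + η * Ctot := by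
        rw [hCtot, Finset.mul_sum, ← Finset.sum_add_distrib]
        exact Finset.sum_congr rfl fun m _ => by ring
    _ ≤ 0 + ε := by
        refine add_le_add hgood ?_
        rw [hη, div_mul_eq_mul_div, div_le_iff₀ (by linarith)]
        nlinarith

/-! ### Label averages of one task -/

section LabelAverage

lemma imbalance_nonneg {X L : Type*} {n : ℕ} (S : Fin n → X × (L → Bool)) (k : L) :
    0 ≤ imbalance S k := by
  unfold imbalance; positivity

variable {X L : Type*} [Fintype L] {n : ℕ}

lemma abs_label_average_le {g : L → ℝ} {M : ℝ} (hM : 0 ≤ M) (h : ∀ k, |g k| ≤ M) :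
    |(1 / (Fintype.card L : ℝ)) * ∑ k, g k| ≤ M := by
  rw [abs_mul, abs_of_nonneg (by positivity), one_div]
  rcases Nat.eq_zero_or_pos (Fintype.card L) with h0 | h0
  · simp [h0, hM]
  · have h0' : (0 : ℝ) < Fintype.card L := by exact_mod_cast h0
    rw [inv_mul_le_iff₀ h0', ← nsmul_eq_mul]
    exact (Finset.abs_sum_le_sum_abs _ _).trans
      (Finset.sum_le_card_nsmul _ _ _ fun k _ => h k)

/-- Jensen's inequality for the square root of a label average. -/
lemma average_sqrt_le_sqrt_average {g : L → ℝ} (hg : ∀ k, 0 ≤ g k) :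
    (1 / (Fintype.card L : ℝ)) * ∑ k, √(g k) ≤ √((1 / (Fintype.card L : ℝ)) * ∑ k, g k) := by
  refine Real.le_sqrt_of_sq_le ?_
  rcases Nat.eq_zero_or_pos (Fintype.card L) with h0 | h0
  · simp [h0]
  have h0' : (0 : ℝ) < Fintype.card L := by exact_mod_cast h0
  have h1 := sq_sum_le_card_mul_sum_sq (s := (Finset.univ : Finset L)) (f := fun k => √(g k))
  simp only [Real.sq_sqrt (hg _), Finset.card_univ] at h1
  rw [mul_pow, one_div]
  calc _ ≤ ((Fintype.card L : ℝ)⁻¹) ^ 2 * (Fintype.card L * ∑ k, g k) :=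
        mul_le_mul_of_nonneg_left h1 (by positivity)
    _ = _ := by field_simp

lemma average_devThreshold_le (S : Fin n → X × (L → Bool)) (κ : DevKind) {Δp Δm : L → ℝ}
    (hΔp : ∀ k, 1 ≤ 1 / Δp k) (hΔm : ∀ k, 1 ≤ 1 / Δm k) {Λ r B δ : ℝ} (hΛ : 0 ≤ Λ) (hr : 0 ≤ r)
    (hB : 0 ≤ B) :
    (1 / (Fintype.card L : ℝ)) * ∑ k, devThreshold S k κ Λ r B δ
      ≤ κ.arity * epsTerm S Δp Δm Λ r + xiTerm S B δ := by
  have hκ := κ.arity_pos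
  set T := 6 * B * √(Real.log (6 / δ) / (2 * n)) with hT
  have hT0 : 0 ≤ T := by positivity
  have h1 : ∀ k, devThreshold S k κ Λ r B δ ≤ κ.arity * (4 * Λ * r / √(n : ℝ))
      * (√(1 / imbalance S k) * (1 / Δp k + 1 / Δm k)) + T * √(1 / imbalance S k) := by
    intro k
    have h2 : (2 : ℝ) ≤ 1 / Δp k + 1 / Δm k := by linarith [hΔp k, hΔm k]
    have h3 : 0 ≤ κ.arity * (4 * Λ * r / √(n : ℝ)) * √(1 / imbalance S k) := by positivity
    unfold devThreshold
    calc _ = κ.arity * (4 * Λ * r / √(n : ℝ)) * √(1 / imbalance S k) * 2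
          + T * √(1 / imbalance S k) := by rw [hT]; ring
      _ ≤ κ.arity * (4 * Λ * r / √(n : ℝ)) * √(1 / imbalance S k) * (1 / Δp k + 1 / Δm k)
          + T * √(1 / imbalance S k) := by
          gcongr
      _ = _ := by ring
  have h4 := average_sqrt_le_sqrt_average (g := fun k => 1 / imbalance S k)
    fun k => one_div_nonneg.2 (imbalance_nonneg S k)
  calc _ ≤ (1 / (Fintype.card L : ℝ)) * ∑ k, (κ.arity * (4 * Λ * r / √(n : ℝ))
          * (√(1 / imbalance S k) * (1 / Δp k + 1 / Δm k)) + T * √(1 / imbalance S k)) :=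
        mul_le_mul_of_nonneg_left (Finset.sum_le_sum fun k _ => h1 k) (by positivity)
    _ = κ.arity * epsTerm S Δp Δm Λ r
          + T * ((1 / (Fintype.card L : ℝ)) * ∑ k, √(1 / imbalance S k)) := by
        rw [Finset.sum_add_distrib, ← Finset.mul_sum, ← Finset.mul_sum]
        unfold epsTerm
        ring
    _ ≤ _ := by
        unfold xiTerm
        exact add_le_add_right (mul_le_mul_of_nonneg_left h4 hT0) _

lemma empGap_le (S : Fin n → X × (L → Bool)) {Δp Δm : L → ℝ} {B : ℝ} (hB : 0 ≤ B)
    {f f' : X → L → ℝ} (hf : ∀ k, LossBounded (Δp k) (Δm k) B (fun x => f x k))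
    (hf' : ∀ k, LossBounded (Δp k) (Δm k) B (fun x => f' x k)) :
    |empGap S Δp Δm f f'| ≤ 2 * B := by
  refine abs_label_average_le (by positivity) fun k => ?_
  exact abs_pairMean_le (posIdx S k) (negIdx S k)
    (h := pairKernel .gap (Δp k) (Δm k) (fun x => f x k) (fun x => f' x k)) (by positivity)
    (abs_pairKernel_le (hf k) (hf' k)) (fun j => (S j).1)

variable [MeasurableSpace X]

lemma average_sampleDev_risk (P : Measure (X × (L → Bool))) (S : Fin n → X × (L → Bool))
    (Δp Δm : L → ℝ) (f f' : X → L → ℝ) :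
    (1 / (Fintype.card L : ℝ)) * ∑ k, sampleDev P S k
        (pairKernel .risk (Δp k) (Δm k) (fun x => f x k) (fun x => f' x k))
      = risk P Δp Δm f - empRisk S Δp Δm f := by
  simp only [sampleDev, Finset.sum_sub_distrib, mul_sub]
  rfl

lemma average_sampleDev_gap (P : Measure (X × (L → Bool))) (S : Fin n → X × (L → Bool))
    (Δp Δm : L → ℝ) (f f' : X → L → ℝ) :
    (1 / (Fintype.card L : ℝ)) * ∑ k, sampleDev P S k
        (pairKernel .gap (Δp k) (Δm k) (fun x => f x k) (fun x => f' x k))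
      = gapRisk P Δp Δm f f' - empGap S Δp Δm f f' := by
  simp only [sampleDev, Finset.sum_sub_distrib, mul_sub]
  rfl

lemma average_sampleDev_negGap (P : Measure (X × (L → Bool))) (S : Fin n → X × (L → Bool))
    (Δp Δm : L → ℝ) (f f' : X → L → ℝ) :
    (1 / (Fintype.card L : ℝ)) * ∑ k, sampleDev P S k
        (pairKernel .negGap (Δp k) (Δm k) (fun x => f x k) (fun x => f' x k))
      = empGap S Δp Δm f f' - gapRisk P Δp Δm f f' := by
  rw [← neg_sub, ← average_sampleDev_gap, ← mul_neg, ← Finset.sum_neg_distrib]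
  congr 1
  refine Finset.sum_congr rfl fun k _ => ?_
  simp only [sampleDev, pairMean, pairKernel, DevKind.apply, integral_neg, Finset.sum_neg_distrib]
  ring

lemma risk_le_risk_add_gapRisk (P : Measure (X × (L → Bool))) {Δp Δm : L → ℝ} {B : ℝ}
    {f f' : X → L → ℝ} (hfm : ∀ k, Measurable fun x => f x k)
    (hfm' : ∀ k, Measurable fun x => f' x k)
    (hf : ∀ k, LossBounded (Δp k) (Δm k) B (fun x => f x k))
    (hf' : ∀ k, LossBounded (Δp k) (Δm k) B (fun x => f' x k)) :
    risk P Δp Δm f ≤ risk P Δp Δm f' + gapRisk P Δp Δm f f' := by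
  unfold risk gapRisk
  rw [← mul_add, ← Finset.sum_add_distrib]
  refine mul_le_mul_of_nonneg_left (Finset.sum_le_sum fun k _ => ?_) (by positivity)
  have hi : ∀ g : X → ℝ, Measurable g → LossBounded (Δp k) (Δm k) B g →
      Integrable (fun z : X × X => rldamLoss (Δp k) (Δm k) g z.1 z.2) (pairLaw P k) :=
    fun g hg hgB => integrable_of_abs_le (measurable_rldamLoss _ _ hg) fun z => by
      rw [abs_of_nonneg (rldamLoss_nonneg _ _ _ _ _)]
      exact hgB.rldamLoss_le _ _
  have h1 := hi _ (hfm k) (hf k)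
  have h2 := hi _ (hfm' k) (hf' k)
  change ∫ z, _ ∂(pairLaw P k) ≤ (∫ z, _ ∂(pairLaw P k)) + ∫ z, _ ∂(pairLaw P k)
  have h3 : Integrable (fun z : X × X => |rldamLoss (Δp k) (Δm k) (fun x => f x k) z.1 z.2
      - rldamLoss (Δp k) (Δm k) (fun x => f' x k) z.1 z.2|) (pairLaw P k) := (h1.sub h2).abs
  rw [← integral_add h2 h3]
  refine integral_mono h1 (h2.add h3) fun z => ?_
  have := le_abs_self (rldamLoss (Δp k) (Δm k) (fun x => f x k) z.1 z.2
    - rldamLoss (Δp k) (Δm k) (fun x => f' x k) z.1 z.2)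
  linarith

end LabelAverage

/-! ### Kernel hypotheses -/

section KernelClass

variable {X K H : Type*} [NormedAddCommGroup H] [InnerProductSpace ℝ H]

lemma kernelClass_lossBounded {Φ : X → H} {Λ B : ℝ} {Δp Δm : K → ℝ}
    (hB : ∀ f ∈ kernelClass (K := K) Φ Λ, ∀ x k,
      hinge (f x k - Δp k) ≤ B ∧ hinge (-(f x k) - Δm k) ≤ B)
    {u : H} (hu : ‖u‖ ≤ Λ) (k : K) : LossBounded (Δp k) (Δm k) B (fun x => ⟪u, Φ x⟫) := fun x =>
  hB (fun x _ => ⟪u, Φ x⟫) ⟨fun _ => u, fun _ => hu, fun _ _ => rfl⟩ x k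

/-- The zero hypothesis has margin loss `1 + Δ`. -/
lemma one_le_of_kernelClass_bound [Nonempty X] {Φ : X → H} {Λ B : ℝ} (hΛ : 0 ≤ Λ) {Δp Δm : K → ℝ}
    {k : K} (hΔp : 0 < Δp k)
    (hB : ∀ f ∈ kernelClass (K := K) Φ Λ, ∀ x k,
      hinge (f x k - Δp k) ≤ B ∧ hinge (-(f x k) - Δm k) ≤ B) : 1 ≤ B := by
  obtain ⟨x⟩ := ‹Nonempty X›
  have h := (kernelClass_lossBounded hB (u := (0 : H)) (by simpa using hΛ) k x).1
  have h2 := (le_max_right _ _).trans h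
  simp only [inner_zero_left] at h2
  linarith

/-- The shifted hinge loss has slope `-1` on `[Δ - 1, Δ]`, so it can be `1/Δ`-Lipschitz only if
`1/Δ ≥ 1`. -/
lemma one_le_one_div_of_lipschitz_hinge {Δ : ℝ} (hΔ : 0 < Δ)
    (h : LipschitzWith (Real.toNNReal (1 / Δ)) fun z => hinge (z - Δ)) : 1 ≤ 1 / Δ := by
  have h1 := h.dist_le_mul (Δ - 1) Δ
  rw [Real.coe_toNNReal _ (by positivity), Real.dist_eq, Real.dist_eq] at h1
  norm_num [hinge] at h1
  simpa using h1

lemma abs_empGap_sub_le_disc {s s' : Finset K} {n n' : ℕ} {ℱ : Set (X → K → ℝ)} {Δp Δm : K → ℝ}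
    {B : ℝ} (hB0 : 0 ≤ B) (hB : ∀ f ∈ ℱ, ∀ k, LossBounded (Δp k) (Δm k) B (fun x => f x k))
    (S : Fin n → X × (s → Bool)) (S' : Fin n' → X × (s' → Bool)) {f f' : X → K → ℝ} (hf : f ∈ ℱ)
    (hf' : f' ∈ ℱ) :
    |empGap S (fun k => Δp k) (fun k => Δm k) (taskOutputs s f) (taskOutputs s f')
      - empGap S' (fun k => Δp k) (fun k => Δm k) (taskOutputs s' f) (taskOutputs s' f')|
    ≤ disc ℱ Δp Δm S S' := by
  refine le_csSup ⟨4 * B, ?_⟩ ⟨f, hf, f', hf', rfl⟩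
  rintro _ ⟨g, hg, g', hg', rfl⟩
  have h1 := empGap_le S (Δp := fun k => Δp k) (Δm := fun k => Δm k) hB0
    (f := taskOutputs s g) (f' := taskOutputs s g') (fun k => hB g hg k) (fun k => hB g' hg' k)
  have h2 := empGap_le S' (Δp := fun k => Δp k) (Δm := fun k => Δm k) hB0
    (f := taskOutputs s' g) (f' := taskOutputs s' g') (fun k => hB g hg k) (fun k => hB g' hg' k)
  exact (abs_sub _ _).trans (by linarith)

end KernelClass

/-! ### Combination of the tasks -/

section Combine

variable {T : ℕ} (t : Fin T)

lemma sum_Iio_add_self (f : Fin T → ℝ) :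
    ∑ i ∈ Finset.Iic t, f i = (∑ i ∈ Finset.Iio t, f i) + f t := by
  rw [← Finset.Iio_insert, Finset.sum_insert (by simp), add_comm]

/-- The weights of the deviations of each kind in the bound for task `t`. -/
def devWeight (β γ : Fin T → ℝ) (i : Fin T) : DevKind → ℝ
  | .risk => if i < t then γ i else if i = t then 1 else 0
  | .gap => if i < t then β i else 0
  | .negGap => if i = t then ∑ j ∈ Finset.Iio t, β j else 0

lemma devWeight_nonneg {β γ : Fin T → ℝ} (hβ : ∀ i < t, 0 ≤ β i) (hγ : ∀ i < t, 0 ≤ γ i)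
    (i : Fin T) (κ : DevKind) : 0 ≤ devWeight t β γ i κ := by
  cases κ <;> simp only [devWeight]
  · split_ifs with h1 h2
    · exact hγ i h1
    · exact zero_le_one
    · exact le_rfl
  · split_ifs with h1
    · exact hβ i h1
    · exact le_rfl
  · split_ifs with h1
    · exact Finset.sum_nonneg fun j hj => hβ j (Finset.mem_Iio.1 hj)
    · exact le_rfl

lemma le_of_devWeight_ne_zero {β γ : Fin T → ℝ} {i : Fin T} {κ : DevKind}
    (h : devWeight t β γ i κ ≠ 0) : i ≤ t := by
  by_contra hi
  have h1 : ¬ i < t := fun h => hi h.le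
  have h2 : i ≠ t := fun h => hi h.le
  cases κ <;> simp [devWeight, h1, h2] at h

lemma sum_devWeight_mul (β γ : Fin T → ℝ) (x : Fin T → DevKind → ℝ) :
    ∑ i, ∑ κ, devWeight t β γ i κ * x i κ
      = (∑ i ∈ Finset.Iio t, γ i * x i .risk) + x t .risk
        + (∑ i ∈ Finset.Iio t, β i * (x i .gap + x t .negGap)) := by
  have hsplit : ∀ g : Fin T → ℝ, (∀ i, ¬ i ≤ t → g i = 0) →
      ∑ i, g i = (∑ i ∈ Finset.Iio t, g i) + g t := by
    intro g hg
    rw [← sum_Iio_add_self]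
    exact (Finset.sum_subset (Finset.subset_univ _) fun i _ hi => hg i (by simpa using hi)).symm
  have hw : ∀ i ∈ Finset.Iio t, ∑ κ, devWeight t β γ i κ * x i κ
      = γ i * x i .risk + β i * x i .gap := by
    intro i hi
    have h1 : i < t := Finset.mem_Iio.1 hi
    simp [DevKind.sum_eq, devWeight, h1, h1.ne]
  rw [hsplit, Finset.sum_congr rfl hw, Finset.sum_add_distrib]
  · simp only [DevKind.sum_eq, devWeight, lt_self_iff_false, if_true, if_false, mul_add,
      Finset.sum_add_distrib, Finset.sum_mul]
    ring
  · intro i hi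
    refine Finset.sum_eq_zero fun κ _ => ?_
    rw [not_imp_comm.1 (le_of_devWeight_ne_zero t (β := β) (γ := γ) (κ := κ)) hi, zero_mul]

/-- The deterministic part of the argument: the share `γ i` of the risk of an old task is estimated
on its memory, the share `α i` by the previous model, and the share `β i` by the previous model and
a gap that is transported to the current task through the discrepancy. -/
lemma sum_risk_le {α β γ R RF Rh ψ gh ε ξ d : Fin T → ℝ} {B : ℝ}
    (hα : ∀ i < t, 0 ≤ α i) (hβ : ∀ i < t, 0 ≤ β i) (hsum : ∀ i < t, α i + β i + γ i = 1)
    (htri : ∀ i, R i ≤ RF i + ψ i) (hd : ∀ i, gh i - gh t ≤ d i)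
    (hdev : (∑ i ∈ Finset.Iio t, γ i * (R i - Rh i - (ε i + ξ i)))
      + (R t - Rh t - (ε t + ξ t))
      + (∑ i ∈ Finset.Iio t, β i * ((ψ i - gh i - (2 * ε i + B * ξ i))
        + (gh t - ψ t - (2 * ε t + B * ξ t)))) ≤ 0) :
    ∑ i ∈ Finset.Iic t, R i ≤ ((∑ i ∈ Finset.Iio t, γ i * Rh i) + Rh t)
      + ((∑ i ∈ Finset.Iio t, γ i * ε i) + ε t + 2 * ∑ i ∈ Finset.Iio t, β i * (ε i + ε t))
      + ((∑ i ∈ Finset.Iio t, γ i * ξ i) + ξ t + B * ∑ i ∈ Finset.Iio t, β i * (ξ i + ξ t))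
      + (∑ i ∈ Finset.Iio t, (α i + β i) * RF i)
      + ((∑ i ∈ Finset.Iio t, α i * ψ i) + ∑ i ∈ Finset.Iio t, β i * ψ t)
      + ∑ i ∈ Finset.Iio t, β i * d i := by
  have h1 : ∑ i ∈ Finset.Iio t, R i
      ≤ ∑ i ∈ Finset.Iio t, (γ i * (R i - Rh i - (ε i + ξ i))
        + β i * ((ψ i - gh i - (2 * ε i + B * ξ i)) + (gh t - ψ t - (2 * ε t + B * ξ t)))
        + γ i * Rh i + γ i * ε i + 2 * (β i * (ε i + ε t)) + γ i * ξ i + B * (β i * (ξ i + ξ t))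
        + (α i + β i) * RF i + α i * ψ i + β i * ψ t + β i * d i) := by
    refine Finset.sum_le_sum fun i hi => ?_
    have hit := Finset.mem_Iio.1 hi
    have e1 : R i = α i * R i + β i * R i + γ i * R i := by
      rw [← add_mul, ← add_mul, hsum i hit, one_mul]
    have e2 := mul_le_mul_of_nonneg_left (htri i) (hα i hit)
    have e3 := mul_le_mul_of_nonneg_left (htri i) (hβ i hit)
    have e4 := mul_le_mul_of_nonneg_left (hd i) (hβ i hit)
    linarith
  simp only [Finset.sum_add_distrib, ← Finset.mul_sum] at h1
  simp only [Finset.sum_add_distrib, mul_add] at h1 hdev ⊢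
  rw [sum_Iio_add_self]
  linarith

end Combine

end

end MLCL

theorem theorem1
    {X K H Ω : Type*} [MeasurableSpace X]
    [NormedAddCommGroup H] [InnerProductSpace ℝ H] [CompleteSpace H]
    [MeasurableSpace Ω] (μ : Measure Ω) [IsProbabilityMeasure μ]
    -- the task sequence: pairwise disjoint label sets and a distribution for each task
    (T : ℕ) (lab : Fin T → Finset K)
    (hlab : ∀ i j, i ≠ j → Disjoint (lab i) (lab j))
    (P : (i : Fin T) → Measure (X × (lab i → Bool))) [∀ i, IsProbabilityMeasure (P i)]
    -- the samples: i.i.d. within each task, with arbitrary dependence between the tasks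
    (n : Fin T → ℕ)
    (D : (i : Fin T) → Fin (n i) → Ω → X × (lab i → Bool))
    (hDmeas : ∀ i j, Measurable (D i j))
    (hDlaw : ∀ i j, μ.map (D i j) = P i)
    (hDindep : ∀ i, iIndepFun (D i) μ)
    -- the kernel, a feature map, and the kernel bounds
    (κ : X → X → ℝ) (Φ : X → H) (hΦ : StronglyMeasurable Φ)
    (hκ : ∀ x x', κ x x' = ⟪Φ x, Φ x'⟫)
    (r : Fin T → ℝ) (hr : ∀ i, 0 < r i) (hκr : ∀ i x, κ x x ≤ r i ^ 2)
    (Λ : ℝ)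
    -- the margins; the shifted hinge losses are Lipschitz with constants `1/Δ`, bounded by `B`
    (Δp Δm : K → ℝ) (hΔp : ∀ k, 0 < Δp k) (hΔm : ∀ k, 0 < Δm k)
    (hLip_p : ∀ k, LipschitzWith (Real.toNNReal (1 / Δp k)) fun z => MLCL.hinge (z - Δp k))
    (hLip_m : ∀ k, LipschitzWith (Real.toNNReal (1 / Δm k)) fun z => MLCL.hinge (z - Δm k))
    (B : ℝ)
    (hB : ∀ f ∈ MLCL.kernelClass (K := K) Φ Λ, ∀ x k,
      MLCL.hinge (f x k - Δp k) ≤ B ∧ MLCL.hinge (-(f x k) - Δm k) ≤ B)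
    -- the current task, the weights and the confidence level
    (t : Fin T) (α β γ : Fin T → ℝ)
    (hα : ∀ i < t, 0 ≤ α i) (hβ : ∀ i < t, 0 ≤ β i) (hγ : ∀ i < t, 0 ≤ γ i)
    (hsum : ∀ i < t, α i + β i + γ i = 1)
    (δ : ℝ) (hδ : 0 < δ) :
    ∃ E : Set Ω, MeasurableSet E ∧ ENNReal.ofReal (1 - δ) ≤ μ E ∧
      ∀ ω ∈ E,
        (∀ i ≤ t, MLCL.AllLabelsSeen fun j => D i j ω) →
        ∀ f ∈ MLCL.kernelClass (K := K) Φ Λ, ∀ F ∈ MLCL.kernelClass (K := K) Φ Λ,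
          let R : Fin T → (X → K → ℝ) → ℝ := fun i g =>
            MLCL.risk (P i) (fun k => Δp k) (fun k => Δm k) (MLCL.taskOutputs (lab i) g)
          let Rhat : Fin T → (X → K → ℝ) → ℝ := fun i g =>
            MLCL.empRisk (fun j => D i j ω) (fun k => Δp k) (fun k => Δm k)
              (MLCL.taskOutputs (lab i) g)
          let ε : Fin T → ℝ := fun i =>
            MLCL.epsTerm (fun j => D i j ω) (fun k => Δp k) (fun k => Δm k) Λ (r i)
          let ξ : Fin T → ℝ := fun i => MLCL.xiTerm (fun j => D i j ω) B δ
          let ψ : Fin T → ℝ := fun i =>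
            MLCL.gapRisk (P i) (fun k => Δp k) (fun k => Δm k)
              (MLCL.taskOutputs (lab i) f) (MLCL.taskOutputs (lab i) F)
          ∑ i ∈ Finset.Iic t, R i f ≤
            ((∑ i ∈ Finset.Iio t, γ i * Rhat i f) + Rhat t f)
            + ((∑ i ∈ Finset.Iio t, γ i * ε i) + ε t
                + 2 * ∑ i ∈ Finset.Iio t, β i * (ε i + ε t))
            + ((∑ i ∈ Finset.Iio t, γ i * ξ i) + ξ t
                + B * ∑ i ∈ Finset.Iio t, β i * (ξ i + ξ t))
            + (∑ i ∈ Finset.Iio t, (α i + β i) * R i F)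
            + ((∑ i ∈ Finset.Iio t, α i * ψ i) + ∑ i ∈ Finset.Iio t, β i * ψ t)
            + ∑ i ∈ Finset.Iio t, β i * MLCL.disc (MLCL.kernelClass (K := K) Φ Λ) Δp Δm
                (fun j => D i j ω) (fun j => D t j ω) := by
  classical
  -- Without labels all risks vanish; without hypotheses there is nothing to prove.
  rcases isEmpty_or_nonempty K with hK | ⟨⟨k₀⟩⟩
  · refine ⟨Set.univ, MeasurableSet.univ, ?_, ?_⟩
    · rw [measure_univ]
      exact ENNReal.ofReal_le_one.2 (by linarith)
    · intro ω _ _ f _ F _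
      have hd : ∀ i, 0 ≤ MLCL.disc (MLCL.kernelClass (K := K) Φ Λ) Δp Δm
          (fun j => D i j ω) (fun j => D t j ω) := fun i => by
        refine Real.sSup_nonneg ?_
        rintro _ ⟨_, _, _, _, rfl⟩
        exact abs_nonneg _
      simpa [MLCL.risk, MLCL.empRisk, MLCL.epsTerm, MLCL.xiTerm, MLCL.gapRisk] using
        Finset.sum_nonneg fun i hi => mul_nonneg (hβ i (Finset.mem_Iio.1 hi)) (hd i)
  rcases (MLCL.kernelClass (K := K) Φ Λ).eq_empty_or_nonempty with hne | ⟨f₀, W₀, hW₀, -⟩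
  · refine ⟨Set.univ, MeasurableSet.univ, ?_, ?_⟩
    · rw [measure_univ]
      exact ENNReal.ofReal_le_one.2 (by linarith)
    · intro ω _ _ f hf
      exact absurd hf (by simp [hne])
  rcases lt_or_ge 1 δ with hδ1 | hδ1
  · exact ⟨∅, MeasurableSet.empty, by
      rw [ENNReal.ofReal_of_nonpos (by linarith)]; exact zero_le, fun ω hω => absurd hω (by simp)⟩
  have hΛ : 0 ≤ Λ := (norm_nonneg _).trans (hW₀ k₀)
  have hX : Nonempty X := by
    obtain ⟨z⟩ := (P t).nonempty_of_neZero
    exact ⟨z.1⟩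
  have hB1 : 1 ≤ B := MLCL.one_le_of_kernelClass_bound hΛ (hΔp k₀) hB
  have hB0 : 0 < B := by linarith
  have hΦr : ∀ i x, ‖Φ x‖ ≤ r i := by
    intro i x
    refine abs_le_of_sq_le_sq' ?_ (hr i).le |>.2
    rw [← real_inner_self_eq_norm_sq, ← hκ]
    exact hκr i x
  have hρp : ∀ k, 1 ≤ 1 / Δp k := fun k =>
    MLCL.one_le_one_div_of_lipschitz_hinge (hΔp k) (hLip_p k)
  have hρm : ∀ k, 1 ≤ 1 / Δm k := fun k =>
    MLCL.one_le_one_div_of_lipschitz_hinge (hΔm k) (hLip_m k)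
  have hscore : ∀ u : H, Measurable fun x => (⟪u, Φ x⟫ : ℝ) := fun u =>
    (stronglyMeasurable_const.inner hΦ).measurable
  -- Dividing the weights by the number of labels turns sums over labels into label averages.
  obtain ⟨E, hEm, hEμ, hE⟩ := MLCL.exists_event_weighted_dev_le P hDmeas hDlaw hDindep hΦ
    (fun i => (hr i).le) hΦr hΛ (fun i (k : lab i) => Δp k) (fun i (k : lab i) => Δm k) hB0
    (fun u hu i k => MLCL.kernelClass_lossBounded hB hu (k : K))
    (a := fun i κ => MLCL.devWeight t β γ i κ * (1 / (Fintype.card (lab i) : ℝ)))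
    (fun i κ => mul_nonneg (MLCL.devWeight_nonneg t hβ hγ i κ) (by positivity)) hδ hδ1
  refine ⟨E, hEm, hEμ, fun ω hω hseen f hf F hF => ?_⟩
  intro R Rhat ε ξ ψ
  obtain ⟨Wf, hWf, hWf'⟩ := id hf
  obtain ⟨WF, hWF, hWF'⟩ := id hF
  have hdev := hE ω hω
    (fun i hi => by
      obtain ⟨κ, hκ'⟩ := hi
      exact hseen i (MLCL.le_of_devWeight_ne_zero t (left_ne_zero_of_mul hκ')))
    (fun i k => Wf k) (fun i k => WF k) (fun i k => hWf k) fun i k => hWF k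
  simp only [← hWf', ← hWF'] at hdev
  -- `x i κ` is the deviation of task `i` minus its contribution to the claimed bound.
  let G : Fin T → (X → K → ℝ) → (X → K → ℝ) → ℝ := fun i g g' =>
    MLCL.empGap (fun j => D i j ω) (fun k => Δp k) (fun k => Δm k)
      (MLCL.taskOutputs (lab i) g) (MLCL.taskOutputs (lab i) g')
  let x : Fin T → MLCL.DevKind → ℝ := fun i κ => match κ with
    | .risk => R i f - Rhat i f - (ε i + ξ i)
    | .gap => ψ i - G i f F - (2 * ε i + B * ξ i)
    | .negGap => G i f F - ψ i - (2 * ε i + B * ξ i)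
  have hξ0 : ∀ i, 0 ≤ ξ i := fun i => by
    simp only [ξ, MLCL.xiTerm]; positivity
  have hx : ∀ i κ, x i κ ≤ (1 / (Fintype.card (lab i) : ℝ)) * ∑ k : lab i,
      (MLCL.sampleDev (P i) (fun j => D i j ω) k
        (MLCL.pairKernel κ (Δp k) (Δm k) (fun x => f x k) (fun x => F x k))
        - MLCL.devThreshold (fun j => D i j ω) k κ Λ (r i) B δ) := by
    intro i κ
    have hthr := MLCL.average_devThreshold_le (fun j => D i j ω) κ (δ := δ)
      (fun k : lab i => hρp k) (fun k => hρm k) hΛ (hr i).le hB0.le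
    have hBξ : ξ i ≤ B * ξ i := le_mul_of_one_le_left (hξ0 i) hB1
    rw [Finset.sum_sub_distrib, mul_sub]
    cases κ
    · have h1 := MLCL.average_sampleDev_risk (P i) (fun j => D i j ω) (fun k => Δp k)
        (fun k => Δm k) (MLCL.taskOutputs (lab i) f) (MLCL.taskOutputs (lab i) F)
      refine sub_le_sub h1.ge (hthr.trans ?_)
      simp only [MLCL.DevKind.arity, one_mul]
      exact le_rfl
    · have h1 := MLCL.average_sampleDev_gap (P i) (fun j => D i j ω) (fun k => Δp k)
        (fun k => Δm k) (MLCL.taskOutputs (lab i) f) (MLCL.taskOutputs (lab i) F)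
      exact sub_le_sub h1.ge (hthr.trans (add_le_add_right hBξ _))
    · have h1 := MLCL.average_sampleDev_negGap (P i) (fun j => D i j ω) (fun k => Δp k)
        (fun k => Δm k) (MLCL.taskOutputs (lab i) f) (MLCL.taskOutputs (lab i) F)
      exact sub_le_sub h1.ge (hthr.trans (add_le_add_right hBξ _))
  have hxsum : ∑ i, ∑ κ, MLCL.devWeight t β γ i κ * x i κ ≤ 0 := by
    refine (Finset.sum_le_sum fun i _ => Finset.sum_le_sum fun κ _ =>
      mul_le_mul_of_nonneg_left (hx i κ) (MLCL.devWeight_nonneg t hβ hγ i κ)).trans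
        (le_trans (le_of_eq ?_) hdev)
    rw [Fintype.sum_sigma]
    refine Finset.sum_congr rfl fun i _ => ?_
    rw [Fintype.sum_prod_type_right]
    refine Finset.sum_congr rfl fun κ _ => ?_
    rw [← mul_assoc, Finset.mul_sum]
  rw [MLCL.sum_devWeight_mul] at hxsum
  have hfB : ∀ g ∈ MLCL.kernelClass (K := K) Φ Λ, ∀ k,
      MLCL.LossBounded (Δp k) (Δm k) B fun x => g x k := fun g hg k x => hB g hg x k
  have hfm : ∀ g ∈ MLCL.kernelClass (K := K) Φ Λ, ∀ k, Measurable fun x => g x k := by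
    rintro g ⟨W, -, hW⟩ k
    simp only [hW]
    exact hscore _
  refine MLCL.sum_risk_le t (R := fun i => R i f) (RF := fun i => R i F) (Rh := fun i => Rhat i f)
    (gh := fun i => G i f F) hα hβ hsum (fun i => ?_) (fun i => ?_) hxsum
  · exact MLCL.risk_le_risk_add_gapRisk (P i) (fun k => hfm f hf k) (fun k => hfm F hF k)
      (fun k => hfB f hf k) fun k => hfB F hF k
  · exact (le_abs_self _).trans (MLCL.abs_empGap_sub_le_disc hB0.le hfB _ _ hf hF)
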